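/- **Setting.** For $p\ge 1$ let $\theta=(\beta_0,\beta_1)$ with $\beta_r=(\beta_{1,r},\dots,\beta_{p,r})\in\mathbb R^p$, $r=0,1$, and put $\alpha_{r,i,j}=e^{\beta_{i,r}+\beta_{j,r}}$. The stationary two-way heterogeneity model (TWHM) $P_\theta$ is the law of symmetric $0/1$ matrices $X^t=(X^t_{i,j})_{1\le i,j\le p}$, $t\ge 0$, with zero diagonal, such that for $i<j$ and $t\ge1$ $$X^t_{i,j}=I(\varepsilon^t_{i,j}=0)+X^{t-1}_{i,j}\,I(\varepsilon^t_{i,j}=1),$$ where the innovations $\varepsilon^t_{i,j}$ ($i<j$, $t\ge 1$) and the initial states $X^0_{i,j}$ ($i<j$) are mutually independent, with $$P(\varepsilon^t_{i,j}=r)=\frac{\alpha_{r,i,j}}{1+\alpha_{0,i,j}+\alpha_{1,i,j}}\ (r=0,1),\quad P(\varepsilon^t_{i,j}=-1)=\frac{1}{1+\alpha_{0,i,j}+\alpha_{1,i,j}},\quad P(X^0_{i,j}=1)=\frac{\alpha_{0,i,j}}{1+\alpha_{0,i,j}}=1-P(X^0_{i,j}=0).$$ Given $X^0,\dots,X^n$,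 the normalised negative log-likelihood conditional on $X^0$ is $$l(\theta)=-\frac1{np}\log\prod_{t=1}^n\prod_{1\le i<j\le p}P_\theta\big(X^t_{i,j}\mid X^{t-1}_{i,j}\big),$$ where $P_\theta(1\mid 0)=\frac{\alpha_{0,i,j}}{1+\alpha_{0,i,j}+\alpha_{1,i,j}}$, $P_\theta(0\mid 1)=\frac{1}{1+\alpha_{0,i,j}+\alpha_{1,i,j}}$, $P_\theta(0\mid 0)=1-P_\theta(1\mid 0)$ and $P_\theta(1\mid1)=1-P_\theta(0\mid 1)$. **Theorem.** Let $K\in\mathbb R$. There are constants $c>0$ and $c_r>0$, depending only on $K$, such that the following holds as $np\to\infty$ with $n\ge2$ and $p\ge3$. Let $\{X^t\}\sim P_{\theta^*}$, where $\theta^*=(\beta_0^*,\beta_1^*)$ may depend on $n$ and $p$ and satisfies * (A1) $\beta^*_{i,1}-\max(\beta^*_{i,0},0)<K$ for all $i=1,\dots,p$; * $\kappa_0+\kappa_1\le c\log(np)$, where $\kappa_r=\|\beta_r^*\|_\infty$. Put $r=c_re^{-4\kappa_0-4\kappa_1}$ and $B_\infty(\theta^*,r)=\{\theta\in\mathbb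 R^{2p}:\|\theta-\theta^*\|_\infty\le r\}$. Then, with probability tending to one, uniformly over all such $\theta^*$, the function $l$ is convex on $B_\infty(\theta^*,r)$ and there is a unique maximum likelihood estimator in this ball, i.e. a unique minimiser of $l$ over $B_\infty(\theta^*,r)$. -/

import Mathlib

open MeasureTheory ProbabilityTheory

namespace TWHM

/-- The index set of pairs `(i, j)` with `1 ≤ i < j ≤ p`. -/
abbrev Edge (p : ℕ) : Type := {e : Fin p × Fin p // e.1 < e.2}

/-- The parameters `θ = (β₀, β₁)` in `ℝ^p × ℝ^p`. The norm of Mathlib on this product is the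
maximum of the absolute values of all `2 p` coordinates, so that `Metric.closedBall θ r` is the
closed `ℓ∞`-ball. -/
abbrev Param (p : ℕ) : Type := (Fin p → ℝ) × (Fin p → ℝ)

/-- `exp (β_{i,0} + β_{j,0})` -/
noncomputable def alpha0 {p : ℕ} (θ : Param p) (i j : Fin p) : ℝ := Real.exp (θ.1 i + θ.1 j)

/-- `exp (β_{i,1} + β_{j,1})` -/
noncomputable def alpha1 {p : ℕ} (θ : Param p) (i j : Fin p) : ℝ := Real.exp (θ.2 i + θ.2 j)

/-- The normalising constant `1 + exp (β_{i,0} + β_{j,0}) + exp (β_{i,1} + β_{j,1})`. -/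
noncomputable def denom {p : ℕ} (θ : Param p) (i j : Fin p) : ℝ :=
  1 + alpha0 θ i j + alpha1 θ i j

/-- The variables that drive the process on the edge `e`: the initial state at time `0` and the
innovations at the times `t ≥ 1`. -/
def driver {p : ℕ} {Ω : Type*} (X ε : ℕ → Fin p → Fin p → Ω → ℤ) (q : Edge p × ℕ) : Ω → ℤ :=
  if q.2 = 0 then X 0 q.1.1.1 q.1.1.2 else ε q.2 q.1.1.1 q.1.1.2

/-- `X` (with `X t i j` the entry `(i, j)` of the adjacency matrix at time `t`) and the innovations
`ε` (used at times `t ≥ 1` and for `i < j` only) form a stationary two-way heterogeneity model with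
parameter `θ = (β₀, β₁)`. -/
structure IsModelWith {p : ℕ} {Ω : Type*} [MeasurableSpace Ω] (μ : Measure Ω) (θ : Param p)
    (X ε : ℕ → Fin p → Fin p → Ω → ℤ) : Prop where
  measurable_X : ∀ t i j, Measurable (X t i j)
  measurable_innov : ∀ t i j, Measurable (ε t i j)
  /-- the networks are undirected -/
  symm : ∀ t i j, X t j i =ᵐ[μ] X t i j
  /-- there are no self-loops -/
  no_loop : ∀ t i, X t i i =ᵐ[μ] fun _ => 0
  /-- the initial states and all the innovations are mutually independent -/
  indep : iIndepFun (driver X ε) μ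
  /-- the initial states follow the stationary marginal distribution -/
  init_one : ∀ i j, i < j → μ.real {ω | X 0 i j ω = 1} = alpha0 θ i j / (1 + alpha0 θ i j)
  init_zero : ∀ i j, i < j → μ.real {ω | X 0 i j ω = 0} = 1 / (1 + alpha0 θ i j)
  /-- the distribution of the innovations -/
  innov_zero : ∀ t i j, 1 ≤ t → i < j → μ.real {ω | ε t i j ω = 0} = alpha0 θ i j / denom θ i j
  innov_one : ∀ t i j, 1 ≤ t → i < j → μ.real {ω | ε t i j ω = 1} = alpha1 θ i j / denom θ i j
  innov_neg_one : ∀ t i j, 1 ≤ t → i < j → μ.real {ω | ε t i j ω = -1} = 1 / denom θ i j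
  /-- `X^t = I(ε^t = 0) + X^{t-1} I(ε^t = 1)` for `t ≥ 1` -/
  step : ∀ t i j, i < j → ∀ᵐ ω ∂μ, X (t + 1) i j ω =
    (if ε (t + 1) i j ω = 0 then 1 else 0) + X t i j ω * (if ε (t + 1) i j ω = 1 then 1 else 0)

/-- `{X^t} ∼ P_θ`: the process `X` is a stationary two-way heterogeneity model with parameter
`θ`. -/
def IsStationaryTWHM {p : ℕ} {Ω : Type*} [MeasurableSpace Ω] (μ : Measure Ω) (θ : Param p)
    (X : ℕ → Fin p → Fin p → Ω → ℤ) : Prop :=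
  ∃ ε : ℕ → Fin p → Fin p → Ω → ℤ, IsModelWith μ θ X ε

/-- The transition probability `P(X^t_{i,j} = b | X^{t-1}_{i,j} = a)` under the parameter `θ`, for
`a` and `b` in `{0, 1}`. -/
noncomputable def transProb {p : ℕ} (θ : Param p) (i j : Fin p) (a b : ℤ) : ℝ :=
  if b = 1 then
    if a = 1 then (alpha0 θ i j + alpha1 θ i j) / denom θ i j else alpha0 θ i j / denom θ i j
  else
    if a = 1 then 1 / denom θ i j else (1 + alpha1 θ i j) / denom θ i j

/-- The likelihood of the parameter `θ`, given the observed networks `x 0, …, x n` and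
conditionally on `x 0`. -/
noncomputable def condLik {p : ℕ} (n : ℕ) (x : ℕ → Fin p → Fin p → ℤ) (θ : Param p) : ℝ :=
  ∏ t ∈ Finset.range n, ∏ e : Edge p,
    transProb θ e.1.1 e.1.2 (x t e.1.1 e.1.2) (x (t + 1) e.1.1 e.1.2)

/-- The normalised negative log-likelihood `l(θ)`. -/
noncomputable def negLogLik {p : ℕ} (n : ℕ) (x : ℕ → Fin p → Fin p → ℤ) (θ : Param p) : ℝ :=
  -(1 / ((n : ℝ) * (p : ℝ))) * Real.log (condLik n x θ)

/-- `θ'` is a maximum likelihood estimator in the set `B`: it lies in `B` and minimises the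
negative log-likelihood over `B`. -/
def IsMLEIn {p : ℕ} (n : ℕ) (x : ℕ → Fin p → Fin p → ℤ) (B : Set (Param p)) (θ' : Param p) : Prop :=
  θ' ∈ B ∧ IsMinOn (negLogLik n x) B θ'

/-- The radius `r = c_r exp (-4 κ₀ - 4 κ₁)`, where `κ₀` and `κ₁` are the `ℓ∞`-norms of the two
halves of `θ`. -/
noncomputable def radius {p : ℕ} (cr : ℝ) (θ : Param p) : ℝ :=
  cr * Real.exp (-4 * ‖θ.1‖ - 4 * ‖θ.2‖)

end TWHM

namespace TWHM

/-! Up to the factor `1 / p`, the negative log-likelihood is a sum over edges of functions of `u =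
β_{i,0} + β_{j,0}` and `v = β_{i,1} + β_{j,1}`. Each is a combination of log-sum-exp terms whose
coefficients are the observed transition frequencies (`negLogLik_eq_sum`). Along a line the second
derivative is a form in the squared increments of `u`, `v` and `u - v`. The first coefficient is
always positive; the other two are affine in the frequencies of `0 → 0` and `1 → 1`.

If these frequencies equal their stationary probabilities, the two coefficients at the true
parameter are positive, in closed form (`curvPersist_stayZero`, `curvMixed_stayOne`). Moving the
parameter by `r` changes every quotient of exponentials by a relative amount of order `r`, while the
cancellation in the coefficients costs at most a factor of order `exp (4 κ₀ + 4 κ₁)`. This is where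
the radius comes from. On the ball each coefficient is therefore at least a deterministic bound
minus a noise term evaluated at the true parameter, so uniformity over the ball is automatic
(`curvPersist_lower`, `curvMixed_lower`).

For bounded `n` the noise of a single edge need not be small, so it is controlled in aggregate. The
noise terms form a symmetric matrix `M` with independent centred entries, and the form `∑ w_e (y_i +
y_j)²` is governed by the row sums and the spectral norm of `M` (`sum_mul_add_sq_le`). The fourth
moments of the row sums and the trace of `(Mᵀ M)²` have expectation of order `p³ V`, with `V` a
bound for the entry variances, because an index pattern contributes only if no edge occurs exactly
once in it. A martingale decomposition of the edge chain gives `V` of order `1 / n`, up to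
exponentials of the parameter size (`integral_sum_deviation_sq_le`). The deterministic curvature has
order `p`, so Markov's inequality at the fourth power of that level bounds the failure probability
by `1 / (n p)` up to such exponentials (`tail_le`).

Off this event the likelihood is strictly convex on a compact ball (`strictConvexOn_closedBall`),
which yields existence and uniqueness of the minimiser. -/

/-! ### Curvature of the loss of one edge. -/

/-- The coefficient of the squared increment of `v` in the second derivative of the loss of an
edge. -/
noncomputable def curvPersist (q u v : ℝ) : ℝ :=
  Real.exp v / (1 + Real.exp u + Real.exp v) ^ 2 - q * (Real.exp v / (1 + Real.exp v) ^ 2)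

/-- The coefficient of the squared difference of the increments of `u` and `v` in the second
derivative of the loss of an edge. -/
noncomputable def curvMixed (q u v : ℝ) : ℝ :=
  Real.exp u * Real.exp v / (1 + Real.exp u + Real.exp v) ^ 2
    - q * (Real.exp u * Real.exp v / (Real.exp u + Real.exp v) ^ 2)

/-- The stationary probability of the transition `0 → 0`. -/
noncomputable def stayZero (u v : ℝ) : ℝ :=
  (1 + Real.exp v) / ((1 + Real.exp u) * (1 + Real.exp u + Real.exp v))

/-- The stationary probability of the transition `1 → 1`. -/
noncomputable def stayOne (u v : ℝ) : ℝ :=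
  Real.exp u * (Real.exp u + Real.exp v) / ((1 + Real.exp u) * (1 + Real.exp u + Real.exp v))

lemma abs_sub_le_of_ratio {x y k : ℝ} (h1 : y ≤ k * x) (h2 : x ≤ k * y)
    (hk : 1 ≤ k) : |y - x| ≤ (k - 1) * x := by
  rw [abs_le]
  constructor
  · by_contra! h
    nlinarith [mul_nonneg (sub_nonneg.2 hk) (sub_nonneg.2 hk)]
  · linarith

lemma exp_le_mul_exp {u v s : ℝ} (h : |u - v| ≤ s) : Real.exp u ≤ Real.exp s * Real.exp v := by
  rw [← Real.exp_add]
  exact Real.exp_le_exp.2 (by linarith [(abs_le.1 h).2])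

lemma expSum_le {u v u' v' s w₀ w₁ w₂ : ℝ} (hu : |u' - u| ≤ s) (hv : |v' - v| ≤ s) (hs : 0 ≤ s)
    (h₀ : 0 ≤ w₀) (h₁ : 0 ≤ w₁) (h₂ : 0 ≤ w₂) :
    w₀ + w₁ * Real.exp u' + w₂ * Real.exp v' ≤
      Real.exp s * (w₀ + w₁ * Real.exp u + w₂ * Real.exp v) := by
  have := mul_le_mul_of_nonneg_left (exp_le_mul_exp hu) h₁
  have := mul_le_mul_of_nonneg_left (exp_le_mul_exp hv) h₂
  have := mul_le_mul_of_nonneg_right (Real.one_le_exp hs) h₀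
  linarith

lemma div_sq_le_of_ratio {x y S T k m : ℝ} (hx : 0 ≤ x) (hS : 0 < S) (hT : 0 < T)
    (hk : 0 ≤ k) (h1 : y ≤ k * x) (h2 : S ≤ m * T) :
    y / T ^ 2 ≤ k * m ^ 2 * (x / S ^ 2) := by
  have h3 : S ^ 2 ≤ (m * T) ^ 2 := pow_le_pow_left₀ hS.le h2 2
  rw [← mul_div_assoc, div_le_div_iff₀ (by positivity) (by positivity)]
  calc y * S ^ 2 ≤ (k * x) * S ^ 2 := by gcongr
    _ ≤ (k * x) * (m * T) ^ 2 := by gcongr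
    _ = _ := by ring

/-- The weights in `{0, 1}` cover all the denominators that occur in the curvatures. The numerator
costs `exp s` and the squared denominator `exp (2 s)`; the exponent is rounded up to `4 s` to match
`exp_mul_exp_div_sq_le`. -/
lemma exp_div_sq_le {u v u' v' s w₀ w₁ w₂ : ℝ} (hu : |u' - u| ≤ s) (hv : |v' - v| ≤ s)
    (h₀ : 0 ≤ w₀) (h₁ : 0 ≤ w₁) (h₂ : 0 < w₂) :
    Real.exp v' / (w₀ + w₁ * Real.exp u' + w₂ * Real.exp v') ^ 2 ≤
      Real.exp (4 * s) * (Real.exp v / (w₀ + w₁ * Real.exp u + w₂ * Real.exp v) ^ 2) := by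
  have hs : 0 ≤ s := (abs_nonneg _).trans hu
  refine (div_sq_le_of_ratio (Real.exp_pos v).le (by positivity) (by positivity)
    (Real.exp_pos s).le (exp_le_mul_exp hv)
    (expSum_le (abs_sub_comm u' u ▸ hu) (abs_sub_comm v' v ▸ hv) hs h₀ h₁ h₂.le)).trans ?_
  gcongr
  rw [← Real.exp_nat_mul, ← Real.exp_add]
  exact Real.exp_le_exp.2 (by push_cast; linarith)

lemma exp_mul_exp_div_sq_le {u v u' v' s w₀ w₁ w₂ : ℝ} (hu : |u' - u| ≤ s) (hv : |v' - v| ≤ s)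
    (h₀ : 0 ≤ w₀) (h₁ : 0 ≤ w₁) (h₂ : 0 < w₂) :
    Real.exp u' * Real.exp v' / (w₀ + w₁ * Real.exp u' + w₂ * Real.exp v') ^ 2 ≤
      Real.exp (4 * s) *
        (Real.exp u * Real.exp v / (w₀ + w₁ * Real.exp u + w₂ * Real.exp v) ^ 2) := by
  have hs : 0 ≤ s := (abs_nonneg _).trans hu
  refine (div_sq_le_of_ratio (x := Real.exp u * Real.exp v)
    (k := Real.exp s * Real.exp s) (by positivity) (by positivity)
    (by positivity) (by positivity) ?_
    (expSum_le (abs_sub_comm u' u ▸ hu) (abs_sub_comm v' v ▸ hv) hs h₀ h₁ h₂.le)).trans ?_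
  · calc _ ≤ (Real.exp s * Real.exp u) * (Real.exp s * Real.exp v) :=
        mul_le_mul (exp_le_mul_exp hu) (exp_le_mul_exp hv) (by positivity) (by positivity)
      _ = _ := by ring
  · apply le_of_eq
    rw [← Real.exp_nat_mul, ← Real.exp_add, ← Real.exp_add]
    congr 2
    push_cast; ring

/-- At the stationary frequency the difference collapses to a single positive quotient; this is the
positivity of the population Hessian. -/
lemma curvPersist_stayZero (u v : ℝ) :
    curvPersist (stayZero u v) u v = Real.exp u * Real.exp v ^ 2 /
      ((1 + Real.exp u + Real.exp v) ^ 2 * (1 + Real.exp u) * (1 + Real.exp v)) := by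
  unfold curvPersist stayZero
  have := Real.exp_pos u
  have := Real.exp_pos v
  field_simp
  ring

lemma curvMixed_stayOne (u v : ℝ) :
    curvMixed (stayOne u v) u v = Real.exp u * Real.exp v ^ 2 /
      ((1 + Real.exp u + Real.exp v) ^ 2 * (1 + Real.exp u) * (Real.exp u + Real.exp v)) := by
  unfold curvMixed stayOne
  have := Real.exp_pos u
  have := Real.exp_pos v
  field_simp
  ring

/-! ### Lower bounds for the curvature near the true parameter. -/

section Bounds

variable {a b E₀ E₁ : ℝ}

/-- With `a = exp u`, `b = exp v` and `E_r = exp (2 κ_r)`, this compares the closed form of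
`curvPersist` with the weight `b / (1 + b)²` of the noise. The loss `(E₀ E₁)²` is the inverse of the
exponential in the radius. -/
lemma mul_sq_le_persist (ha : 0 < a) (hb : 0 < b) (ha₀ : 1 ≤ a * E₀) (ha₁ : a ≤ E₀)
    (hb₀ : 1 ≤ b * E₁) (h₀ : 1 ≤ E₀) (h₁ : 1 ≤ E₁) :
    (1 + a + b) ^ 2 * (1 + a) ≤ 16 * (E₀ * E₁) ^ 2 * (a * b * (1 + b)) := by
  have hD : 1 + a + b ≤ (1 + a) * (1 + b) := by nlinarith [mul_pos ha hb]
  have h3 : (1 + a) ^ 3 ≤ 8 * (a * E₀ ^ 2) := by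
    rcases le_total a 1 with h | h
    · calc (1 + a) ^ 3 ≤ 2 ^ 3 := pow_le_pow_left₀ (by positivity) (by linarith) 3
        _ ≤ 8 * (a * E₀ ^ 2) := by nlinarith
    · calc (1 + a) ^ 3 ≤ (2 * a) ^ 3 := pow_le_pow_left₀ (by positivity) (by linarith) 3
        _ = 8 * (a * a ^ 2) := by ring
        _ ≤ 8 * (a * E₀ ^ 2) := by gcongr
  have hb3 : 1 + b ≤ 2 * (b * E₁) := by nlinarith
  calc (1 + a + b) ^ 2 * (1 + a) ≤ ((1 + a) * (1 + b)) ^ 2 * (1 + a) := by gcongr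
    _ = (1 + a) ^ 3 * (1 + b) * (1 + b) := by ring
    _ ≤ (8 * (a * E₀ ^ 2)) * (2 * (b * E₁)) * (1 + b) := by gcongr
    _ = 16 * (E₀ ^ 2 * E₁) * (a * b * (1 + b)) := by ring
    _ ≤ 16 * (E₀ ^ 2 * E₁ ^ 2) * (a * b * (1 + b)) := by gcongr; nlinarith
    _ = _ := by ring

lemma mul_sq_le_mixed (ha : 0 < a) (hb : 0 < b) (ha₀ : 1 ≤ a * E₀) (ha₁ : a ≤ E₀)
    (hb₀ : 1 ≤ b * E₁) (h₀ : 1 ≤ E₀) (h₁ : 1 ≤ E₁) :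
    (1 + a + b) ^ 2 * (1 + a) ≤ 16 * (E₀ * E₁) ^ 2 * (b * (a + b)) := by
  have hE : 1 ≤ E₀ * E₁ := one_le_mul_of_one_le_of_one_le h₀ h₁
  have hbE : b ≤ b * (E₀ * E₁) := le_mul_of_one_le_right hb.le hE
  have h4 : E₀ ≤ E₀ * (b * E₁) := le_mul_of_one_le_right (by linarith) hb₀
  have hD : 1 + a + b ≤ 3 * b * E₀ * E₁ := by nlinarith
  have h5 : (1 + a + b) * (1 + a) ≤ 4 * E₀ * (a + b) := by
    rcases le_total a 1 with h | h
    · have : 1 + a + b ≤ 2 * E₀ * (a + b) := by nlinarith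
      nlinarith
    · have : 1 + a + b ≤ 2 * (a + b) := by linarith
      nlinarith
  calc (1 + a + b) ^ 2 * (1 + a) = (1 + a + b) * ((1 + a + b) * (1 + a)) := by ring
    _ ≤ (3 * b * E₀ * E₁) * (4 * E₀ * (a + b)) := by gcongr
    _ = 12 * (E₀ ^ 2 * E₁) * (b * (a + b)) := by ring
    _ ≤ 16 * (E₀ ^ 2 * E₁ ^ 2) * (b * (a + b)) := by gcongr <;> nlinarith
    _ = _ := by ring

end Bounds

section Perturbation

variable {u v u' v' κ₀ κ₁ r q : ℝ}

lemma one_le_exp_mul_exp {u κ : ℝ} (hu : |u| ≤ 2 * κ) : 1 ≤ Real.exp u * Real.exp (2 * κ) := by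
  rw [← Real.exp_add]
  exact Real.one_le_exp (by linarith [(abs_le.1 hu).1])

/-- The constant in the radius is fixed here: `exp (8 r) - 1 ≤ 16 r`, and `4 * 16 * 16 = 1024`. -/
lemma exp_sub_one_le (hr₀ : 0 ≤ r) (hr : r ≤ 1 / 1024 * Real.exp (-4 * κ₀ - 4 * κ₁))
    (hκ₀ : 0 ≤ κ₀) (hκ₁ : 0 ≤ κ₁) :
    4 * (Real.exp (4 * (2 * r)) - 1) * (16 * (Real.exp (2 * κ₀) * Real.exp (2 * κ₁)) ^ 2) ≤ 1 := by
  have h1 : Real.exp (-4 * κ₀ - 4 * κ₁) ≤ 1 := Real.exp_le_one_iff.2 (by linarith)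
  have h2 : Real.exp (4 * (2 * r)) - 1 ≤ 2 * (8 * r) := by
    have := Real.abs_exp_sub_one_le (x := 4 * (2 * r)) (by rw [abs_of_nonneg] <;> linarith)
    rw [abs_of_nonneg (a := 4 * (2 * r)) (by linarith)] at this
    linarith [le_abs_self (Real.exp (4 * (2 * r)) - 1)]
  have h3 : Real.exp (-4 * κ₀ - 4 * κ₁) * (Real.exp (2 * κ₀) * Real.exp (2 * κ₁)) ^ 2 = 1 := by
    rw [← Real.exp_add, ← Real.exp_nat_mul, ← Real.exp_add, Real.exp_eq_one_iff]
    push_cast; ring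
  calc _ ≤ 4 * (2 * (8 * (1 / 1024 * Real.exp (-4 * κ₀ - 4 * κ₁)))) *
        (16 * (Real.exp (2 * κ₀) * Real.exp (2 * κ₁)) ^ 2) := by gcongr; linarith
    _ = Real.exp (-4 * κ₀ - 4 * κ₁) * (Real.exp (2 * κ₀) * Real.exp (2 * κ₁)) ^ 2 := by ring
    _ = 1 := h3
    _ ≤ 1 := le_rfl

/-- The coefficient is affine in `q`, so replacing `q` by its mean produces the noise term exactly.
Moving `(u, v)` costs a deterministic amount, uniform in `q ∈ [0, 1]`, that half of the population
curvature absorbs. -/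
lemma curvPersist_lower (hu : |u| ≤ 2 * κ₀) (hv : |v| ≤ 2 * κ₁) (hr₀ : 0 ≤ r)
    (hr : r ≤ 1 / 1024 * Real.exp (-4 * κ₀ - 4 * κ₁)) (hu' : |u' - u| ≤ 2 * r)
    (hv' : |v' - v| ≤ 2 * r) (hq₀ : 0 ≤ q) (hq₁ : q ≤ 1) :
    curvPersist (stayZero u v) u v / 2
      - (q - stayZero u v) * (Real.exp v / (1 + Real.exp v) ^ 2) ≤ curvPersist q u' v' := by
  have hκ₀ : 0 ≤ κ₀ := by linarith [abs_nonneg u]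
  have hκ₁ : 0 ≤ κ₁ := by linarith [abs_nonneg v]
  have ha := Real.exp_pos u
  have hb := Real.exp_pos v
  have hk : 1 ≤ Real.exp (4 * (2 * r)) := Real.one_le_exp (by linarith)
  have hu'' := abs_sub_comm u' u ▸ hu'
  have hv'' := abs_sub_comm v' v ▸ hv'
  have d1 := abs_sub_le_of_ratio (x := Real.exp v / (1 + 1 * Real.exp u + 1 * Real.exp v) ^ 2)
    (exp_div_sq_le hu' hv' zero_le_one zero_le_one one_pos)
    (exp_div_sq_le hu'' hv'' zero_le_one zero_le_one one_pos) hk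
  have d2 := abs_sub_le_of_ratio (x := Real.exp v / (1 + 0 * Real.exp u + 1 * Real.exp v) ^ 2)
    (exp_div_sq_le hu' hv' zero_le_one le_rfl one_pos)
    (exp_div_sq_le hu'' hv'' zero_le_one le_rfl one_pos) hk
  simp only [one_mul, zero_mul, add_zero] at d1 d2
  have hle : Real.exp v / (1 + Real.exp u + Real.exp v) ^ 2 ≤
      Real.exp v / (1 + Real.exp v) ^ 2 := by
    gcongr; linarith
  have key := mul_sq_le_persist ha hb (one_le_exp_mul_exp hu) (Real.exp_le_exp.2 (abs_le.1 hu).2)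
    (one_le_exp_mul_exp hv) (Real.one_le_exp (by linarith)) (Real.one_le_exp (by linarith))
  have hsm := exp_sub_one_le hr₀ hr hκ₀ hκ₁
  -- The factor 2 accounts for the movement of both quotients, each measured against the larger one.
  have main : 2 * ((Real.exp (4 * (2 * r)) - 1) * (Real.exp v / (1 + Real.exp v) ^ 2)) ≤
      curvPersist (stayZero u v) u v / 2 := by
    rw [curvPersist_stayZero]
    set k := Real.exp (4 * (2 * r)) - 1
    have hk0 : 0 ≤ k := sub_nonneg.2 hk
    set a := Real.exp u
    set b := Real.exp v
    rw [← mul_div_assoc, ← mul_div_assoc, div_div, div_le_div_iff₀ (by positivity) (by positivity)]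
    have h2 : 4 * k * ((1 + a + b) ^ 2 * (1 + a)) ≤ a * b * (1 + b) := by
      refine (mul_le_mul_of_nonneg_left key (mul_nonneg zero_le_four hk0)).trans ?_
      have := mul_le_mul_of_nonneg_right hsm (show 0 ≤ a * b * (1 + b) by positivity)
      linarith
    have := mul_le_mul_of_nonneg_right h2 (show 0 ≤ b * (1 + b) by positivity)
    linarith
  have hx := mul_le_mul_of_nonneg_left hle (sub_nonneg.2 hk)
  have hy : q * (Real.exp v' / (1 + Real.exp v') ^ 2 - Real.exp v / (1 + Real.exp v) ^ 2) ≤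
      (Real.exp (4 * (2 * r)) - 1) * (Real.exp v / (1 + Real.exp v) ^ 2) :=
    (mul_le_mul_of_nonneg_left (le_abs_self _) hq₀).trans
      ((mul_le_of_le_one_left (abs_nonneg _) hq₁).trans d2)
  have e1 := (abs_le.1 d1).1
  unfold curvPersist at *
  linarith

/-- Here all of the population curvature may be spent on the movement of the parameter: the other
two coefficients suffice for strict positivity. -/
lemma curvMixed_lower (hu : |u| ≤ 2 * κ₀) (hv : |v| ≤ 2 * κ₁) (hr₀ : 0 ≤ r)
    (hr : r ≤ 1 / 1024 * Real.exp (-4 * κ₀ - 4 * κ₁)) (hu' : |u' - u| ≤ 2 * r)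
    (hv' : |v' - v| ≤ 2 * r) (hq₀ : 0 ≤ q) (hq₁ : q ≤ 1) :
    - ((q - stayOne u v) * (Real.exp u * Real.exp v / (Real.exp u + Real.exp v) ^ 2)) ≤
      curvMixed q u' v' := by
  have hκ₀ : 0 ≤ κ₀ := by linarith [abs_nonneg u]
  have hκ₁ : 0 ≤ κ₁ := by linarith [abs_nonneg v]
  have ha := Real.exp_pos u
  have hb := Real.exp_pos v
  have hk : 1 ≤ Real.exp (4 * (2 * r)) := Real.one_le_exp (by linarith)
  have hu'' := abs_sub_comm u' u ▸ hu'
  have hv'' := abs_sub_comm v' v ▸ hv'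
  have d1 := abs_sub_le_of_ratio
    (x := Real.exp u * Real.exp v / (1 + 1 * Real.exp u + 1 * Real.exp v) ^ 2)
    (exp_mul_exp_div_sq_le hu' hv' zero_le_one zero_le_one one_pos)
    (exp_mul_exp_div_sq_le hu'' hv'' zero_le_one zero_le_one one_pos) hk
  have d2 := abs_sub_le_of_ratio
    (x := Real.exp u * Real.exp v / (0 + 1 * Real.exp u + 1 * Real.exp v) ^ 2)
    (exp_mul_exp_div_sq_le hu' hv' le_rfl zero_le_one one_pos)
    (exp_mul_exp_div_sq_le hu'' hv'' le_rfl zero_le_one one_pos) hk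
  simp only [one_mul, zero_add] at d1 d2
  have hle : Real.exp u * Real.exp v / (1 + Real.exp u + Real.exp v) ^ 2 ≤
      Real.exp u * Real.exp v / (Real.exp u + Real.exp v) ^ 2 := by
    gcongr; linarith
  have key := mul_sq_le_mixed ha hb (one_le_exp_mul_exp hu) (Real.exp_le_exp.2 (abs_le.1 hu).2)
    (one_le_exp_mul_exp hv) (Real.one_le_exp (by linarith)) (Real.one_le_exp (by linarith))
  have hsm := exp_sub_one_le hr₀ hr hκ₀ hκ₁
  have main : 2 * ((Real.exp (4 * (2 * r)) - 1) *
      (Real.exp u * Real.exp v / (Real.exp u + Real.exp v) ^ 2)) ≤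
      curvMixed (stayOne u v) u v := by
    rw [curvMixed_stayOne]
    set k := Real.exp (4 * (2 * r)) - 1
    have hk0 : 0 ≤ k := sub_nonneg.2 hk
    set a := Real.exp u
    set b := Real.exp v
    rw [← mul_div_assoc, ← mul_div_assoc, div_le_div_iff₀ (by positivity) (by positivity)]
    have h2 : 4 * k * ((1 + a + b) ^ 2 * (1 + a)) ≤ b * (a + b) := by
      refine (mul_le_mul_of_nonneg_left key (mul_nonneg zero_le_four hk0)).trans ?_
      have := mul_le_mul_of_nonneg_right hsm (show 0 ≤ b * (a + b) by positivity)
      linarith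
    have h3 : 2 * k * ((1 + a + b) ^ 2 * (1 + a)) ≤ b * (a + b) :=
      le_trans (by gcongr; norm_num) h2
    have := mul_le_mul_of_nonneg_right h3 (show 0 ≤ a * b * (a + b) by positivity)
    linarith
  have hx := mul_le_mul_of_nonneg_left hle (sub_nonneg.2 hk)
  have hy : q * (Real.exp u' * Real.exp v' / (Real.exp u' + Real.exp v') ^ 2
        - Real.exp u * Real.exp v / (Real.exp u + Real.exp v) ^ 2) ≤
      (Real.exp (4 * (2 * r)) - 1) * (Real.exp u * Real.exp v / (Real.exp u + Real.exp v) ^ 2) :=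
    (mul_le_mul_of_nonneg_left (le_abs_self _) hq₀).trans
      ((mul_le_of_le_one_left (abs_nonneg _) hq₁).trans d2)
  have e1 := (abs_le.1 d1).1
  unfold curvMixed at *
  linarith

lemma denom_le {κ : ℝ} (hu : |u| ≤ κ) (hv : |v| ≤ κ) :
    1 + Real.exp u + Real.exp v ≤ 3 * Real.exp κ := by
  have := Real.one_le_exp ((abs_nonneg u).trans hu)
  have := Real.exp_le_exp.2 (abs_le.1 hu).2
  have := Real.exp_le_exp.2 (abs_le.1 hv).2
  linarith

lemma exp_neg_le_curvPersist {κ : ℝ} (hu : |u| ≤ κ) (hv : |v| ≤ κ) :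
    Real.exp (-7 * κ) / 36 ≤ curvPersist (stayZero u v) u v := by
  have ha := Real.exp_pos u
  have hb := Real.exp_pos v
  have hκ := (abs_nonneg u).trans hu
  have h1 := Real.one_le_exp hκ
  have h2 := Real.exp_le_exp.2 (abs_le.1 hu).2
  have h3 := Real.exp_le_exp.2 (abs_le.1 hv).2
  rw [curvPersist_stayZero]
  calc Real.exp (-7 * κ) / 36
      = Real.exp (-κ) * Real.exp (-κ) ^ 2 /
        ((3 * Real.exp κ) ^ 2 * (2 * Real.exp κ) * (2 * Real.exp κ)) := by
        have : Real.exp (-7 * κ) = Real.exp (-κ) ^ 7 := by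
          rw [← Real.exp_nat_mul]; congr 1; push_cast; ring
        rw [this, Real.exp_neg]
        field_simp
        norm_num
    _ ≤ _ := by
        have h4 := denom_le hu hv
        have h5 := Real.exp_le_exp.2 (abs_le.1 hu).1
        have h6 := Real.exp_le_exp.2 (abs_le.1 hv).1
        gcongr <;> linarith

lemma exp_neg_le_curvBirth {κ : ℝ} (hu : |u| ≤ κ) (hv : |v| ≤ κ) :
    Real.exp (-3 * κ) / 9 ≤ Real.exp u / (1 + Real.exp u + Real.exp v) ^ 2 := by
  calc Real.exp (-3 * κ) / 9 = Real.exp (-κ) / (3 * Real.exp κ) ^ 2 := by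
        have : Real.exp (-3 * κ) = Real.exp (-κ) ^ 3 := by
          rw [← Real.exp_nat_mul]; congr 1; push_cast; ring
        rw [this, Real.exp_neg]
        field_simp
        norm_num
    _ ≤ _ := by
        have h4 := denom_le hu hv
        have h5 := Real.exp_le_exp.2 (abs_le.1 hu).1
        have := Real.exp_pos u
        have := Real.exp_pos v
        gcongr

end Perturbation

/-! ### Strict convexity along lines and derivatives of log-sum-exp. -/

lemma strictConvexOn_of_hasDerivAt_line {E : Type*} [AddCommGroup E] [Module ℝ E] {s : Set E}
    (hs : Convex ℝ s) {f : E → ℝ}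
    (h : ∀ x ∈ s, ∀ y ∈ s, x ≠ y → ∃ f' f'' : ℝ → ℝ,
      (∀ t, HasDerivAt (fun t : ℝ => f (x + t • (y - x))) (f' t) t) ∧
      (∀ t, HasDerivAt f' (f'' t) t) ∧ ∀ t ∈ Set.Icc (0 : ℝ) 1, 0 < f'' t) :
    StrictConvexOn ℝ s f := by
  refine ⟨hs, fun x hx y hy hxy a b ha hb hab => ?_⟩
  obtain ⟨f', f'', h1, h2, h3⟩ := h x hx y hy hxy
  have hd : deriv (fun t : ℝ => f (x + t • (y - x))) = f' := funext fun t => (h1 t).deriv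
  have hconv : StrictConvexOn ℝ (Set.Icc (0 : ℝ) 1) (fun t : ℝ => f (x + t • (y - x))) := by
    refine strictConvexOn_of_deriv2_pos' (convex_Icc 0 1)
      (fun t _ => (h1 t).continuousAt.continuousWithinAt) fun t ht => ?_
    rw [Function.iterate_succ, Function.iterate_one, Function.comp_apply, hd, (h2 t).deriv]
    exact h3 t ht
  have := hconv.2 (x := 0) (by simp) (y := 1) (by simp) zero_ne_one ha hb hab
  simp only [smul_eq_mul, mul_zero, mul_one, zero_add, zero_smul, add_zero, one_smul,
    add_sub_cancel] at this
  rw [smul_eq_mul, smul_eq_mul]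
  convert this using 2
  rw [← eq_sub_iff_add_eq] at hab
  subst hab
  module

lemma hasDerivAt_log_expSum {w₀ w₁ w₂ u v u' v' : ℝ} (h₀ : 0 ≤ w₀) (h₁ : 0 ≤ w₁) (h₂ : 0 < w₂)
    (t : ℝ) :
    HasDerivAt (fun t => Real.log (w₀ + w₁ * Real.exp (u + t * u') + w₂ * Real.exp (v + t * v')))
      ((w₁ * (Real.exp (u + t * u') * u') + w₂ * (Real.exp (v + t * v') * v')) /
        (w₀ + w₁ * Real.exp (u + t * u') + w₂ * Real.exp (v + t * v'))) t := by
  have hl (a a' : ℝ) : HasDerivAt (fun t => a + t * a') a' t := by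
    simpa using ((hasDerivAt_id t).mul_const a').const_add a
  have hs := (((hl u u').exp.const_mul w₁).const_add w₀).add ((hl v v').exp.const_mul w₂)
  exact hs.log (ne_of_gt (by simp only [Pi.add_apply]; positivity))

/-- The second derivative of log-sum-exp is the variance of the increments `0, u', v'` under the
Gibbs weights, written as a sum over pairs of squared differences. -/
lemma hasDerivAt_deriv_log_expSum {w₀ w₁ w₂ u v u' v' : ℝ} (h₀ : 0 ≤ w₀) (h₁ : 0 ≤ w₁)
    (h₂ : 0 < w₂) (t : ℝ) :
    HasDerivAt (fun t => (w₁ * (Real.exp (u + t * u') * u') + w₂ * (Real.exp (v + t * v') * v')) /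
        (w₀ + w₁ * Real.exp (u + t * u') + w₂ * Real.exp (v + t * v')))
      ((w₀ * w₁ * (Real.exp (u + t * u') * u' ^ 2) + w₀ * w₂ * (Real.exp (v + t * v') * v' ^ 2)
        + w₁ * w₂ * (Real.exp (u + t * u') * Real.exp (v + t * v') * (u' - v') ^ 2)) /
        (w₀ + w₁ * Real.exp (u + t * u') + w₂ * Real.exp (v + t * v')) ^ 2) t := by
  have hl (a a' : ℝ) : HasDerivAt (fun t => a + t * a') a' t := by
    simpa using ((hasDerivAt_id t).mul_const a').const_add a
  have hs := (((hl u u').exp.const_mul w₁).const_add w₀).add ((hl v v').exp.const_mul w₂)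
  have hn := (((hl u u').exp.mul_const u').const_mul w₁).add
    (((hl v v').exp.mul_const v').const_mul w₂)
  have h := hn.div hs (ne_of_gt (by simp only [Pi.add_apply]; positivity))
  refine h.congr_deriv ?_
  simp only [Pi.add_apply]
  congr 1
  ring

/-! ### The likelihood as a sum of edge losses. -/

/-- The normalised negative log-likelihood of an edge, as a function of the frequencies of its
transitions `0 → 1`, `1 → 1` and `0 → 0`. -/
noncomputable def edgeLoss (q₀₁ q₁₁ q₀₀ u v : ℝ) : ℝ :=
  Real.log (1 + Real.exp u + Real.exp v) - q₀₁ * u - q₁₁ * Real.log (Real.exp u + Real.exp v)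
    - q₀₀ * Real.log (1 + Real.exp v)

lemma continuous_edgeLoss (q₀₁ q₁₁ q₀₀ : ℝ) :
    Continuous fun z : ℝ × ℝ => edgeLoss q₀₁ q₁₁ q₀₀ z.1 z.2 := by
  unfold edgeLoss
  have h1 : ∀ z : ℝ × ℝ, 1 + Real.exp z.1 + Real.exp z.2 ≠ 0 := fun z => by positivity
  have h2 : ∀ z : ℝ × ℝ, Real.exp z.1 + Real.exp z.2 ≠ 0 := fun z => by positivity
  have h3 : ∀ z : ℝ × ℝ, 1 + Real.exp z.2 ≠ 0 := fun z => by positivity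
  fun_prop (disch := assumption)

/-- The frequency `q₀₁` multiplies a linear term and drops out of the second derivative; this is why
only the frequencies of `0 → 0` and `1 → 1` need to be controlled. -/
lemma exists_hasDerivAt_edgeLoss (q₀₁ q₁₁ q₀₀ u v u' v' : ℝ) :
    ∃ f' : ℝ → ℝ,
      (∀ t, HasDerivAt (fun t => edgeLoss q₀₁ q₁₁ q₀₀ (u + t * u') (v + t * v')) (f' t) t) ∧
      ∀ t, HasDerivAt f'
        (Real.exp (u + t * u') / (1 + Real.exp (u + t * u') + Real.exp (v + t * v')) ^ 2 * u' ^ 2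
          + curvPersist q₀₀ (u + t * u') (v + t * v') * v' ^ 2
          + curvMixed q₁₁ (u + t * u') (v + t * v') * (u' - v') ^ 2) t := by
  have hl (a a' t : ℝ) : HasDerivAt (fun t => a + t * a') a' t := by
    simpa using ((hasDerivAt_id t).mul_const a').const_add a
  have h1 (t : ℝ) := (((hasDerivAt_log_expSum (u := u) (v := v) (u' := u') (v' := v') zero_le_one
    zero_le_one one_pos t).sub ((hl u u' t).const_mul q₀₁)).sub
    ((hasDerivAt_log_expSum (u := u) (v := v) (u' := u') (v' := v') le_rfl
    zero_le_one one_pos t).const_mul q₁₁)).sub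
    ((hasDerivAt_log_expSum (u := u) (v := v) (u' := u') (v' := v') zero_le_one
    le_rfl one_pos t).const_mul q₀₀)
  have h2 (t : ℝ) := (((hasDerivAt_deriv_log_expSum (u := u) (v := v) (u' := u') (v' := v')
    zero_le_one zero_le_one one_pos t).sub_const (q₀₁ * u')).sub
    ((hasDerivAt_deriv_log_expSum (u := u) (v := v) (u' := u') (v' := v') le_rfl
    zero_le_one one_pos t).const_mul q₁₁)).sub
    ((hasDerivAt_deriv_log_expSum (u := u) (v := v) (u' := u') (v' := v') zero_le_one
    le_rfl one_pos t).const_mul q₀₀)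
  refine ⟨_, fun t => (h1 t).congr_of_eventuallyEq (.of_forall fun t => ?_),
    fun t => (h2 t).congr_deriv ?_⟩
  · simp [edgeLoss]
  · simp only [one_mul, zero_mul, mul_zero, zero_add, add_zero, curvPersist, curvMixed]
    ring

/-- The frequency of the transition `0 → 1`. -/
noncomputable def freqBirth (n : ℕ) (f : ℕ → ℤ) : ℝ :=
  1 / (n : ℝ) * ∑ t ∈ Finset.range n, if f (t + 1) = 1 then if f t = 1 then 0 else 1 else 0

/-- The frequency of the transition `1 → 1`. -/
noncomputable def freqStayOne (n : ℕ) (f : ℕ → ℤ) : ℝ :=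
  1 / (n : ℝ) * ∑ t ∈ Finset.range n, if f (t + 1) = 1 then if f t = 1 then 1 else 0 else 0

/-- The frequency of the transition `0 → 0`. -/
noncomputable def freqStayZero (n : ℕ) (f : ℕ → ℤ) : ℝ :=
  1 / (n : ℝ) * ∑ t ∈ Finset.range n, if f (t + 1) = 1 then 0 else if f t = 1 then 0 else 1

lemma average_mem_Icc {n : ℕ} (hn : 0 < n) {g : ℕ → ℝ} (h₀ : ∀ t, 0 ≤ g t) (h₁ : ∀ t, g t ≤ 1) :
    1 / (n : ℝ) * ∑ t ∈ Finset.range n, g t ∈ Set.Icc (0 : ℝ) 1 := by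
  have hn' : (0 : ℝ) < n := Nat.cast_pos.2 hn
  refine ⟨mul_nonneg (by positivity) (Finset.sum_nonneg fun t _ => h₀ t), ?_⟩
  have : ∑ t ∈ Finset.range n, g t ≤ n := by
    simpa using Finset.sum_le_card_nsmul (Finset.range n) g 1 fun t _ => h₁ t
  rw [one_div, inv_mul_le_iff₀ hn']
  linarith

lemma freqStayOne_mem_Icc {n : ℕ} (hn : 0 < n) (f : ℕ → ℤ) :
    freqStayOne n f ∈ Set.Icc (0 : ℝ) 1 :=
  average_mem_Icc hn (fun t => by split_ifs <;> norm_num) fun t => by split_ifs <;> norm_num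

lemma freqStayZero_mem_Icc {n : ℕ} (hn : 0 < n) (f : ℕ → ℤ) :
    freqStayZero n f ∈ Set.Icc (0 : ℝ) 1 :=
  average_mem_Icc hn (fun t => by split_ifs <;> norm_num) fun t => by split_ifs <;> norm_num

/-- The log-odds `β_{i,0} + β_{j,0}` of the edge `e`. -/
def birthPar {p : ℕ} (θ : Param p) (e : Edge p) : ℝ := θ.1 e.1.1 + θ.1 e.1.2

/-- The log-odds `β_{i,1} + β_{j,1}` of the edge `e`. -/
def persistPar {p : ℕ} (θ : Param p) (e : Edge p) : ℝ := θ.2 e.1.1 + θ.2 e.1.2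

lemma transProb_pos {p : ℕ} (θ : Param p) (i j : Fin p) (a b : ℤ) : 0 < transProb θ i j a b := by
  unfold transProb denom alpha0 alpha1
  split_ifs <;> positivity

lemma log_transProb {p : ℕ} (θ : Param p) (e : Edge p) (a b : ℤ) :
    -Real.log (transProb θ e.1.1 e.1.2 a b) =
      edgeLoss (if b = 1 then if a = 1 then 0 else 1 else 0)
        (if b = 1 then if a = 1 then 1 else 0 else 0)
        (if b = 1 then 0 else if a = 1 then 0 else 1) (birthPar θ e) (persistPar θ e) := by
  unfold transProb edgeLoss denom alpha0 alpha1 birthPar persistPar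
  set u := θ.1 e.1.1 + θ.1 e.1.2
  set v := θ.2 e.1.1 + θ.2 e.1.2
  split_ifs <;> rw [Real.log_div (by positivity) (by positivity)] <;> simp

lemma sum_edgeLoss {ι : Type*} (s : Finset ι) (a b c : ι → ℝ) (k u v : ℝ) (hk : k * s.card = 1) :
    k * ∑ t ∈ s, edgeLoss (a t) (b t) (c t) u v =
      edgeLoss (k * ∑ t ∈ s, a t) (k * ∑ t ∈ s, b t) (k * ∑ t ∈ s, c t) u v := by
  unfold edgeLoss
  simp only [Finset.sum_sub_distrib, ← Finset.sum_mul, Finset.sum_const, nsmul_eq_mul]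
  linear_combination Real.log (1 + Real.exp u + Real.exp v) * hk

lemma negLogLik_eq_sum {n p : ℕ} (hn : 0 < n) (x : ℕ → Fin p → Fin p → ℤ) (θ : Param p) :
    negLogLik n x θ = 1 / (p : ℝ) * ∑ e : Edge p,
      edgeLoss (freqBirth n fun t => x t e.1.1 e.1.2) (freqStayOne n fun t => x t e.1.1 e.1.2)
        (freqStayZero n fun t => x t e.1.1 e.1.2) (birthPar θ e) (persistPar θ e) := by
  have hn' : (n : ℝ) ≠ 0 := Nat.cast_ne_zero.2 hn.ne'
  have h (e : Edge p) := sum_edgeLoss (Finset.range n)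
    (fun t => if x (t + 1) e.1.1 e.1.2 = 1 then if x t e.1.1 e.1.2 = 1 then 0 else 1 else 0)
    (fun t => if x (t + 1) e.1.1 e.1.2 = 1 then if x t e.1.1 e.1.2 = 1 then 1 else 0 else 0)
    (fun t => if x (t + 1) e.1.1 e.1.2 = 1 then 0 else if x t e.1.1 e.1.2 = 1 then 0 else 1)
    (1 / (n : ℝ)) (birthPar θ e) (persistPar θ e) (by simp [hn'])
  unfold freqBirth freqStayOne freqStayZero
  simp only [← h, ← log_transProb]
  unfold negLogLik condLik
  rw [Real.log_prod fun t _ => (Finset.prod_pos fun e _ => transProb_pos _ _ _ _ _).ne']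
  simp only [Real.log_prod fun e _ => (transProb_pos _ _ _ _ _).ne', Finset.sum_neg_distrib]
  rw [← Finset.mul_sum, Finset.sum_neg_distrib, Finset.sum_comm]
  field_simp

/-- The negative log-likelihood is strictly convex on a convex set on which its second derivatives
along lines are positive. -/
lemma strictConvexOn_negLogLik {n p : ℕ} (hn : 0 < n) (hp : 0 < p) (x : ℕ → Fin p → Fin p → ℤ)
    {s : Set (Param p)} (hs : Convex ℝ s)
    (h : ∀ θ ∈ s, ∀ d : Param p, d ≠ 0 → 0 < ∑ e : Edge p,
      (Real.exp (birthPar θ e) / (1 + Real.exp (birthPar θ e) + Real.exp (persistPar θ e)) ^ 2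
          * birthPar d e ^ 2
        + curvPersist (freqStayZero n fun t => x t e.1.1 e.1.2) (birthPar θ e) (persistPar θ e)
          * persistPar d e ^ 2
        + curvMixed (freqStayOne n fun t => x t e.1.1 e.1.2) (birthPar θ e) (persistPar θ e)
          * (birthPar d e - persistPar d e) ^ 2)) :
    StrictConvexOn ℝ s (negLogLik n x) := by
  have hp' : (0 : ℝ) < 1 / (p : ℝ) := by positivity
  refine strictConvexOn_of_hasDerivAt_line hs fun θ hθ θ' hθ' hne => ?_
  choose f' h1 h2 using fun e : Edge p => exists_hasDerivAt_edgeLoss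
    (freqBirth n fun t => x t e.1.1 e.1.2) (freqStayOne n fun t => x t e.1.1 e.1.2)
    (freqStayZero n fun t => x t e.1.1 e.1.2) (birthPar θ e) (persistPar θ e)
    (birthPar (θ' - θ) e) (persistPar (θ' - θ) e)
  have hb (t : ℝ) (e : Edge p) :
      birthPar (θ + t • (θ' - θ)) e = birthPar θ e + t * birthPar (θ' - θ) e := by
    simp [birthPar]; ring
  have hp (t : ℝ) (e : Edge p) :
      persistPar (θ + t • (θ' - θ)) e = persistPar θ e + t * persistPar (θ' - θ) e := by
    simp [persistPar]; ring
  have d1 (t : ℝ) := (HasDerivAt.fun_sum (u := Finset.univ) fun e _ => h1 e t).const_mul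
    (1 / (p : ℝ))
  have d2 (t : ℝ) := (HasDerivAt.fun_sum (u := Finset.univ) fun e _ => h2 e t).const_mul
    (1 / (p : ℝ))
  refine ⟨_, _, fun t => (d1 t).congr_of_eventuallyEq (.of_forall fun t => ?_), d2,
    fun t ht => ?_⟩
  · simp only [negLogLik_eq_sum hn, hb, hp]
  · have hmem : θ + t • (θ' - θ) ∈ s := hs.add_smul_sub_mem hθ hθ' ht
    have := h _ hmem (θ' - θ) (sub_ne_zero.2 hne.symm)
    simp only [hb, hp] at this
    exact mul_pos hp' this

lemma continuous_negLogLik {n p : ℕ} (hn : 0 < n) (x : ℕ → Fin p → Fin p → ℤ) :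
    Continuous (negLogLik n x) := by
  have : negLogLik n x = _ := funext fun θ => negLogLik_eq_sum hn x θ
  rw [this]
  refine continuous_const.mul (continuous_finsetSum _ fun e _ => ?_)
  refine (continuous_edgeLoss _ _ _).comp (f := fun θ => (birthPar θ e, persistPar θ e)) ?_
  unfold birthPar persistPar
  fun_prop

lemma existsUnique_isMLEIn {n p : ℕ} {x : ℕ → Fin p → Fin p → ℤ} {s : Set (Param p)}
    (hc : IsCompact s) (hne : s.Nonempty) (hcont : Continuous (negLogLik n x))
    (hs : StrictConvexOn ℝ s (negLogLik n x)) : ∃! θ, IsMLEIn n x s θ := by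
  obtain ⟨θ, hθ, hmin⟩ := hc.exists_isMinOn hne hcont.continuousOn
  exact ⟨θ, ⟨hθ, hmin⟩, fun θ' h => hs.eq_of_isMinOn h.2 hmin h.1 hθ⟩

/-! ### Quadratic forms on the complete graph. -/

/-- The symmetric matrix with zero diagonal whose entries are given by a function of the edges. -/
noncomputable def symExt {p : ℕ} (w : Edge p → ℝ) (i j : Fin p) : ℝ :=
  if h : i < j then w ⟨(i, j), h⟩ else if h : j < i then w ⟨(j, i), h⟩ else 0

lemma symExt_self {p : ℕ} (w : Edge p → ℝ) (i : Fin p) : symExt w i i = 0 := by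
  simp [symExt]

lemma sum_sum_symExt_mul {p : ℕ} (w : Edge p → ℝ) (F : Fin p → Fin p → ℝ) :
    ∑ i, ∑ j, symExt w i j * F i j =
      ∑ e : Edge p, w e * (F e.1.1 e.1.2 + F e.1.2 e.1.1) := by
  have key (F : Fin p → Fin p → ℝ) : ∑ e : Edge p, w e * F e.1.1 e.1.2 =
      ∑ x : Fin p × Fin p, (if h : x.1 < x.2 then w ⟨x, h⟩ else 0) * F x.1 x.2 := by
    refine Fintype.sum_of_injective (fun e : Edge p => e.1) Subtype.val_injective _ _ ?_ ?_
    · intro x hx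
      have : ¬ x.1 < x.2 := fun h => hx ⟨⟨x, h⟩, rfl⟩
      simp [this]
    · intro e
      simp [e.2]
  simp only [mul_add, Finset.sum_add_distrib]
  rw [key F, key fun i j => F j i, Fintype.sum_prod_type, Fintype.sum_prod_type,
    Finset.sum_comm (f := fun i j => (if h : (i, j).1 < (i, j).2 then w ⟨(i, j), h⟩ else 0) *
      F (i, j).2 (i, j).1), ← Finset.sum_add_distrib]
  refine Finset.sum_congr rfl fun i _ => ?_
  rw [← Finset.sum_add_distrib]
  refine Finset.sum_congr rfl fun j _ => ?_
  unfold symExt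
  rcases lt_trichotomy i j with h | rfl | h
  · simp [h, h.asymm]
  · simp
  · simp [h, h.asymm]

/-- Expanding the square splits the form into a signless Laplacian: the diagonal matrix of row sums
plus the weight matrix itself. -/
lemma sum_mul_add_sq {p : ℕ} (w : Edge p → ℝ) (y : Fin p → ℝ) :
    ∑ e : Edge p, w e * (y e.1.1 + y e.1.2) ^ 2 =
      ∑ i, y i ^ 2 * ∑ j, symExt w i j + ∑ i, y i * ∑ j, symExt w i j * y j := by
  have h1 := sum_sum_symExt_mul w fun i _ => y i ^ 2
  have h2 := sum_sum_symExt_mul w fun i j => y i * y j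
  have e1 : ∑ i, y i ^ 2 * ∑ j, symExt w i j = ∑ i, ∑ j, symExt w i j * y i ^ 2 := by
    simp only [Finset.mul_sum, mul_comm]
  have e2 : ∑ i, y i * ∑ j, symExt w i j * y j = ∑ i, ∑ j, symExt w i j * (y i * y j) := by
    simp only [Finset.mul_sum, mul_left_comm]
  rw [e1, e2, h1, h2, ← Finset.sum_add_distrib]
  exact Finset.sum_congr rfl fun e _ => by ring

/-- For unit weights the form equals `(p - 2) ∑ y_i² + (∑ y_i)²`. Positivity of the factor `p - 2`
is where `p ≥ 3` enters. -/
lemma sub_two_mul_le_sum_add_sq {p : ℕ} (y : Fin p → ℝ) :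
    ((p : ℝ) - 2) * ∑ i, y i ^ 2 ≤ ∑ e : Edge p, (y e.1.1 + y e.1.2) ^ 2 := by
  have h := sum_mul_add_sq (fun _ : Edge p => (1 : ℝ)) y
  simp only [one_mul] at h
  have hM (i j : Fin p) : symExt (fun _ => (1 : ℝ)) i j = 1 - if i = j then 1 else 0 := by
    unfold symExt
    rcases lt_trichotomy i j with h | rfl | h
    · simp [h, h.ne]
    · simp
    · simp [h, h.asymm, h.ne']
  rw [h]
  simp only [hM, sub_mul, Finset.sum_sub_distrib, one_mul, ite_mul, zero_mul, Finset.sum_ite_eq,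
    Finset.mem_univ, if_true, Finset.sum_const, Finset.card_univ, Fintype.card_fin, nsmul_eq_mul,
    mul_one, mul_sub, ← Finset.sum_mul]
  have h2 : ∑ i, y i * y i = ∑ i, y i ^ 2 := Finset.sum_congr rfl fun i _ => by ring
  rw [h2]
  nlinarith [mul_self_nonneg (∑ i, y i)]

/-- The sum of the fourth powers of the row sums of a matrix. -/
noncomputable def rowMoment {p : ℕ} (M : Fin p → Fin p → ℝ) : ℝ := ∑ i, (∑ j, M i j) ^ 4

/-- The sum of the squares of the entries of `Mᵀ M`, i.e. the trace of `(Mᵀ M) ^ 2`. -/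
noncomputable def traceMoment {p : ℕ} (M : Fin p → Fin p → ℝ) : ℝ :=
  ∑ k, ∑ l, (∑ i, M i k * M i l) ^ 2

/-- Cauchy–Schwarz twice: first `(yᵀ M y)² ≤ |y|² |M y|²`, then `|M y|² = yᵀ Mᵀ M y` against the
Frobenius norm of `Mᵀ M`. -/
lemma sq_sum_mul_le_traceMoment {p : ℕ} (M : Fin p → Fin p → ℝ) (y : Fin p → ℝ) :
    (∑ i, y i * ∑ j, M i j * y j) ^ 4 ≤ (∑ i, y i ^ 2) ^ 4 * traceMoment M := by
  have h1 : (∑ i, y i * ∑ j, M i j * y j) ^ 2 ≤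
      (∑ i, y i ^ 2) * ∑ i, (∑ j, M i j * y j) ^ 2 := Finset.sum_mul_sq_le_sq_mul_sq _ _ _
  have h2 : ∑ i, (∑ j, M i j * y j) ^ 2 =
      ∑ x : Fin p × Fin p, (y x.1 * y x.2) * ∑ i, M i x.1 * M i x.2 := by
    rw [Fintype.sum_prod_type]
    have (i : Fin p) : (∑ j, M i j * y j) ^ 2 = ∑ k, ∑ l, M i k * y k * (M i l * y l) := by
      rw [sq, Finset.sum_mul_sum]
    simp only [this, Finset.mul_sum]
    rw [Finset.sum_comm]
    refine Finset.sum_congr rfl fun k _ => ?_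
    rw [Finset.sum_comm]
    exact Finset.sum_congr rfl fun l _ => Finset.sum_congr rfl fun i _ => by ring
  have h3 : (∑ i, (∑ j, M i j * y j) ^ 2) ^ 2 ≤ (∑ i, y i ^ 2) ^ 2 * traceMoment M := by
    rw [h2]
    refine (Finset.sum_mul_sq_le_sq_mul_sq _ _ _).trans (le_of_eq ?_)
    have : ∑ k, ∑ l, (y k * y l) ^ 2 = (∑ i, y i ^ 2) ^ 2 := by
      rw [sq (∑ i, y i ^ 2), Finset.sum_mul_sum]
      simp only [mul_pow]
    rw [Fintype.sum_prod_type, Fintype.sum_prod_type, traceMoment, this]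
  calc (∑ i, y i * ∑ j, M i j * y j) ^ 4 = ((∑ i, y i * ∑ j, M i j * y j) ^ 2) ^ 2 := by ring
    _ ≤ ((∑ i, y i ^ 2) * ∑ i, (∑ j, M i j * y j) ^ 2) ^ 2 := by gcongr
    _ = (∑ i, y i ^ 2) ^ 2 * (∑ i, (∑ j, M i j * y j) ^ 2) ^ 2 := by ring
    _ ≤ (∑ i, y i ^ 2) ^ 2 * ((∑ i, y i ^ 2) ^ 2 * traceMoment M) := by gcongr
    _ = _ := by ring

lemma sum_mul_add_sq_le {p : ℕ} {w : Edge p → ℝ} {τ : ℝ} (hτ : 0 ≤ τ)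
    (h1 : rowMoment (symExt w) ≤ τ ^ 4) (h2 : traceMoment (symExt w) ≤ τ ^ 4) (y : Fin p → ℝ) :
    ∑ e : Edge p, w e * (y e.1.1 + y e.1.2) ^ 2 ≤ 2 * τ * ∑ i, y i ^ 2 := by
  have hS : 0 ≤ ∑ i, y i ^ 2 := Finset.sum_nonneg fun i _ => sq_nonneg _
  have hr (i : Fin p) : ∑ j, symExt w i j ≤ τ := by
    refine (le_abs_self _).trans (le_of_pow_le_pow_left₀ four_ne_zero hτ ?_)
    rw [Even.pow_abs (by decide)]
    exact (Finset.single_le_sum (f := fun i => (∑ j, symExt w i j) ^ 4)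
      (fun i _ => by positivity) (Finset.mem_univ i)).trans h1
  have ht : ∑ i, y i * ∑ j, symExt w i j * y j ≤ τ * ∑ i, y i ^ 2 := by
    refine (le_abs_self _).trans (le_of_pow_le_pow_left₀ four_ne_zero (by positivity) ?_)
    rw [Even.pow_abs (by decide), mul_pow]
    refine (sq_sum_mul_le_traceMoment _ _).trans ?_
    rw [mul_comm]
    gcongr
  have hd : ∑ i, y i ^ 2 * ∑ j, symExt w i j ≤ τ * ∑ i, y i ^ 2 := by
    rw [Finset.mul_sum]
    refine Finset.sum_le_sum fun i _ => ?_
    rw [mul_comm]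
    exact mul_le_mul_of_nonneg_right (hr i) (sq_nonneg _)
  rw [sum_mul_add_sq]
  linarith

lemma rowMoment_nonneg {p : ℕ} (M : Fin p → Fin p → ℝ) : 0 ≤ rowMoment M :=
  Finset.sum_nonneg fun _ _ => by positivity

lemma traceMoment_nonneg {p : ℕ} (M : Fin p → Fin p → ℝ) : 0 ≤ traceMoment M :=
  Finset.sum_nonneg fun _ _ => Finset.sum_nonneg fun _ _ => sq_nonneg _

/-! ### Fourth moments of a symmetric matrix with independent centred entries. -/

section FourthMoment

variable {Ω ι : Type*} [MeasurableSpace Ω] {μ : Measure Ω}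

lemma integrable_of_abs_le [IsFiniteMeasure μ] {f : Ω → ℝ} (hf : Measurable f) {C : ℝ}
    (h : ∀ ω, |f ω| ≤ C) : Integrable f μ :=
  Integrable.of_bound hf.aestronglyMeasurable C (Filter.Eventually.of_forall h)

lemma integral_mul_prod_eq_zero {W : ι → Ω → ℝ} (hind : iIndepFun W μ)
    (hm : ∀ e, Measurable (W e)) {a b c d : ι} (h0 : ∫ ω, W a ω ∂μ = 0)
    (hb : a ≠ b) (hc : a ≠ c) (hd : a ≠ d) :
    ∫ ω, W a ω * (W b ω * W c ω * W d ω) ∂μ = 0 := by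
  classical
  have hdis : Disjoint ({a} : Finset ι) {b, c, d} := by simp [hb, hc, hd]
  have h := hind.indepFun_finset _ _ hdis hm
  have hb' : b ∈ ({b, c, d} : Finset ι) := by simp
  have hc' : c ∈ ({b, c, d} : Finset ι) := by simp
  have hd' : d ∈ ({b, c, d} : Finset ι) := by simp
  have hx (e : ({b, c, d} : Finset ι)) : Measurable fun f : ({b, c, d} : Finset ι) → ℝ => f e :=
    measurable_pi_apply e
  have hψ : Measurable fun f : ({b, c, d} : Finset ι) → ℝ => f ⟨b, hb'⟩ * f ⟨c, hc'⟩ * f ⟨d, hd'⟩ :=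
    ((hx ⟨b, hb'⟩).mul (hx ⟨c, hc'⟩)).mul (hx ⟨d, hd'⟩)
  have h2 := h.comp (measurable_pi_apply ⟨a, Finset.mem_singleton_self a⟩) hψ
  have h3 := h2.integral_fun_mul_eq_mul_integral
    ((hm a).aestronglyMeasurable)
    (((hm b).mul (hm c)).mul (hm d)).aestronglyMeasurable
  simp only [Function.comp_def] at h3
  rw [h3, h0, zero_mul]

end FourthMoment

lemma exists_edge_symExt {p : ℕ} {i j : Fin p} (hij : i ≠ j) :
    ∃ e : Edge p, s(e.1.1, e.1.2) = s(i, j) ∧ ∀ w : Edge p → ℝ, symExt w i j = w e := by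
  rcases lt_or_gt_of_ne hij with h | h
  · exact ⟨⟨(i, j), h⟩, rfl, fun w => by simp [symExt, h]⟩
  · exact ⟨⟨(j, i), h⟩, Sym2.eq_swap, fun w => by simp [symExt, h, h.asymm]⟩

section RandomMatrix

variable {Ω : Type*} {p : ℕ} {W : Edge p → Ω → ℝ} {V : ℝ}

/-- The product of four entries of the random matrix. -/
noncomputable def prodFour (W : Edge p → Ω → ℝ) (x y z t : Fin p × Fin p) (ω : Ω) : ℝ :=
  symExt (fun e => W e ω) x.1 x.2 * (symExt (fun e => W e ω) y.1 y.2 *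
    symExt (fun e => W e ω) z.1 z.2 * symExt (fun e => W e ω) t.1 t.2)

lemma prodFour_swap₂ (x y z t : Fin p × Fin p) : prodFour W x y z t = prodFour W y x z t := by
  ext ω; unfold prodFour; ring

lemma prodFour_swap₃ (x y z t : Fin p × Fin p) : prodFour W x y z t = prodFour W z y x t := by
  ext ω; unfold prodFour; ring

lemma prodFour_swap₄ (x y z t : Fin p × Fin p) : prodFour W x y z t = prodFour W t y z x := by
  ext ω; unfold prodFour; ring

lemma rowMoment_eq_sum (ω : Ω) : rowMoment (symExt fun e => W e ω) =
    ∑ i, ∑ j, ∑ k, ∑ l, ∑ m, prodFour W (i, j) (i, k) (i, l) (i, m) ω := by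
  unfold rowMoment prodFour
  simp only [← Finset.mul_sum, ← Finset.sum_mul]
  exact Finset.sum_congr rfl fun i _ => by ring

lemma traceMoment_eq_sum (ω : Ω) : traceMoment (symExt fun e => W e ω) =
    ∑ k, ∑ l, ∑ i, ∑ j, prodFour W (i, k) (i, l) (j, k) (j, l) ω := by
  unfold traceMoment prodFour
  refine Finset.sum_congr rfl fun k _ => Finset.sum_congr rfl fun l _ => ?_
  rw [sq, Finset.sum_mul_sum]
  exact Finset.sum_congr rfl fun i _ => Finset.sum_congr rfl fun j _ => by ring

variable [MeasurableSpace Ω] {μ : Measure Ω}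

/-- A family of independent, centred random variables indexed by the edges that are bounded by one
and have variance at most `V`. -/
structure IsNoise (μ : Measure Ω) (W : Edge p → Ω → ℝ) (V : ℝ) : Prop where
  indep : iIndepFun W μ
  measurable : ∀ e, Measurable (W e)
  centred : ∀ e, ∫ ω, W e ω ∂μ = 0
  abs_le_one : ∀ e ω, |W e ω| ≤ 1
  variance_le : ∀ e, ∫ ω, W e ω ^ 2 ∂μ ≤ V
  nonneg : 0 ≤ V

namespace IsNoise

lemma measurable_symExt (h : IsNoise μ W V) (i j : Fin p) :
    Measurable fun ω => symExt (fun e => W e ω) i j := by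
  rcases eq_or_ne i j with rfl | hij
  · simp [symExt_self]
  · obtain ⟨e, -, he⟩ := exists_edge_symExt hij
    simpa only [he] using h.measurable e

lemma abs_symExt_le (h : IsNoise μ W V) (i j : Fin p) (ω : Ω) :
    |symExt (fun e => W e ω) i j| ≤ 1 := by
  rcases eq_or_ne i j with rfl | hij
  · simp [symExt_self]
  · obtain ⟨e, -, he⟩ := exists_edge_symExt hij
    simpa only [he] using h.abs_le_one e ω

lemma integral_symExt_sq_le (h : IsNoise μ W V) (i j : Fin p) :
    ∫ ω, symExt (fun e => W e ω) i j ^ 2 ∂μ ≤ V := by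
  rcases eq_or_ne i j with rfl | hij
  · simpa [symExt_self] using h.nonneg
  · obtain ⟨e, -, he⟩ := exists_edge_symExt hij
    simpa only [he] using h.variance_le e

lemma integrable_prodFour [IsProbabilityMeasure μ] (h : IsNoise μ W V) (x y z t : Fin p × Fin p) :
    Integrable (prodFour W x y z t) μ := by
  refine integrable_of_abs_le (C := 1) ?_ fun ω => ?_
  · exact (h.measurable_symExt _ _).mul
      (((h.measurable_symExt _ _).mul (h.measurable_symExt _ _)).mul (h.measurable_symExt _ _))
  · unfold prodFour
    simp only [abs_mul]
    have := h.abs_symExt_le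
    exact mul_le_one₀ (this _ _ _) (by positivity) (mul_le_one₀ (mul_le_one₀ (this _ _ _)
      (by positivity) (this _ _ _)) (by positivity) (this _ _ _))

lemma integral_prodFour_eq_zero (h : IsNoise μ W V) {x y z t : Fin p × Fin p}
    (hy : s(x.1, x.2) ≠ s(y.1, y.2)) (hz : s(x.1, x.2) ≠ s(z.1, z.2))
    (ht : s(x.1, x.2) ≠ s(t.1, t.2)) : ∫ ω, prodFour W x y z t ω ∂μ = 0 := by
  unfold prodFour
  rcases eq_or_ne x.1 x.2 with h1 | h1
  · simp [h1, symExt_self]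
  rcases eq_or_ne y.1 y.2 with h2 | h2
  · simp [h2, symExt_self]
  rcases eq_or_ne z.1 z.2 with h3 | h3
  · simp [h3, symExt_self]
  rcases eq_or_ne t.1 t.2 with h4 | h4
  · simp [h4, symExt_self]
  obtain ⟨a, ha, ha'⟩ := exists_edge_symExt h1
  obtain ⟨b, hb, hb'⟩ := exists_edge_symExt h2
  obtain ⟨c, hc, hc'⟩ := exists_edge_symExt h3
  obtain ⟨d, hd, hd'⟩ := exists_edge_symExt h4
  simp only [ha', hb', hc', hd']
  refine integral_mul_prod_eq_zero h.indep h.measurable (h.centred a) ?_ ?_ ?_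
  · rintro rfl; exact hy (ha.symm.trans hb)
  · rintro rfl; exact hz (ha.symm.trans hc)
  · rintro rfl; exact ht (ha.symm.trans hd)

/-- A repeated factor gives a square, and the other two factors are at most one in absolute value.
Spending only one variance is enough, so no bound on higher moments is needed. -/
lemma integral_prodFour_le [IsProbabilityMeasure μ] (h : IsNoise μ W V) {x y z t : Fin p × Fin p}
    (hx : x = y ∨ x = z ∨ x = t) : ∫ ω, prodFour W x y z t ω ∂μ ≤ V := by
  have key (a b c : ℝ) (hb : |b| ≤ 1) (hc : |c| ≤ 1) : a ^ 2 * (b * c) ≤ a ^ 2 := by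
    have : b * c ≤ 1 := (le_abs_self _).trans (by
      rw [abs_mul]; exact mul_le_one₀ hb (abs_nonneg _) hc)
    nlinarith [sq_nonneg a]
  refine le_trans (integral_mono (h.integrable_prodFour x y z t) ?_ fun ω => ?_)
    (h.integral_symExt_sq_le x.1 x.2)
  · exact integrable_of_abs_le (C := 1) ((h.measurable_symExt _ _).pow_const 2) fun ω => by
      rw [abs_pow]; exact pow_le_one₀ (abs_nonneg _) (h.abs_symExt_le _ _ _)
  · have ha := h.abs_symExt_le
    unfold prodFour
    rcases hx with rfl | rfl | rfl
    · exact le_of_eq_of_le (by ring) (key _ _ _ (ha z.1 z.2 ω) (ha t.1 t.2 ω))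
    · exact le_of_eq_of_le (by ring) (key _ _ _ (ha y.1 y.2 ω) (ha t.1 t.2 ω))
    · exact le_of_eq_of_le (by ring) (key _ _ _ (ha y.1 y.2 ω) (ha z.1 z.2 ω))

lemma integral_prodFour_row_le [IsProbabilityMeasure μ] (h : IsNoise μ W V) (i j k l m : Fin p) :
    ∫ ω, prodFour W (i, j) (i, k) (i, l) (i, m) ω ∂μ ≤
      V * ((if j = k then if l = m then 1 else 0 else 0) +
        (if j = l then if k = m then 1 else 0 else 0) +
        (if j = m then if k = l then 1 else 0 else 0)) := by
  have hV := h.nonneg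
  have hn : 0 ≤ ((if j = k then if l = m then 1 else 0 else 0) +
        (if j = l then if k = m then 1 else 0 else 0) +
        (if j = m then if k = l then 1 else 0 else 0) : ℝ) := by
    split_ifs <;> norm_num
  -- Either some index differs from the other three, and its independent centred factor kills the
  -- expectation, or the four indices match in pairs.
  have h1 : (j ≠ k ∧ j ≠ l ∧ j ≠ m) ∨ (k ≠ j ∧ k ≠ l ∧ k ≠ m) ∨ (l ≠ k ∧ l ≠ j ∧ l ≠ m) ∨
      (m ≠ k ∧ m ≠ l ∧ m ≠ j) ∨ ((j = k ∧ l = m) ∨ (j = l ∧ k = m) ∨ (j = m ∧ k = l)) := by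
    grind
  have hs {a b : Fin p} (hab : a ≠ b) : s((i, a).1, (i, a).2) ≠ s((i, b).1, (i, b).2) := by
    simp only [ne_eq, Sym2.eq_iff]; grind
  rcases h1 with h1 | h1 | h1 | h1 | h1
  · rw [h.integral_prodFour_eq_zero (hs h1.1) (hs h1.2.1) (hs h1.2.2)]
    positivity
  · rw [prodFour_swap₂, h.integral_prodFour_eq_zero (hs h1.1) (hs h1.2.1) (hs h1.2.2)]
    positivity
  · rw [prodFour_swap₃, h.integral_prodFour_eq_zero (hs h1.1) (hs h1.2.1) (hs h1.2.2)]
    positivity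
  · rw [prodFour_swap₄, h.integral_prodFour_eq_zero (hs h1.1) (hs h1.2.1) (hs h1.2.2)]
    positivity
  · refine (h.integral_prodFour_le (by grind)).trans (le_mul_of_one_le_right hV ?_)
    rcases h1 with ⟨rfl, rfl⟩ | ⟨rfl, rfl⟩ | ⟨rfl, rfl⟩ <;> simp <;> split_ifs <;> norm_num

lemma integral_rowMoment_le [IsProbabilityMeasure μ] (h : IsNoise μ W V) :
    ∫ ω, rowMoment (symExt fun e => W e ω) ∂μ ≤ 3 * (p : ℝ) ^ 3 * V := by
  simp only [rowMoment_eq_sum]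
  have hi := h.integrable_prodFour
  simp (disch := intros; fun_prop) only [integral_finsetSum]
  calc _ ≤ ∑ i : Fin p, ∑ j : Fin p, ∑ k : Fin p, ∑ l : Fin p, ∑ m : Fin p,
        V * ((if j = k then if l = m then 1 else 0 else 0) +
        (if j = l then if k = m then 1 else 0 else 0) +
        (if j = m then if k = l then 1 else 0 else 0)) := by
        gcongr; exact h.integral_prodFour_row_le _ _ _ _ _
    _ = _ := by
        simp [mul_add, Finset.sum_add_distrib]
        ring

/-- The four entries are the edges of the closed walk `k, i, l, j, k`. If `i ≠ j` and `k ≠ l`, the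
edge `{i, k}` can only coincide with `{j, l}`, and this forces `i = l`. -/
lemma integral_prodFour_trace_le [IsProbabilityMeasure μ] (h : IsNoise μ W V) (i j k l : Fin p) :
    ∫ ω, prodFour W (i, k) (i, l) (j, k) (j, l) ω ∂μ ≤
      V * ((if i = j then 1 else 0) + if k = l then 1 else 0) := by
  have hV := h.nonneg
  by_cases hij : i = j
  · refine (h.integral_prodFour_le (by grind)).trans (le_mul_of_one_le_right hV ?_)
    simp only [hij, if_true]
    split_ifs <;> norm_num
  by_cases hkl : k = l
  · refine (h.integral_prodFour_le (by grind)).trans (le_mul_of_one_le_right hV ?_)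
    simp [hij, hkl]
  simp only [hij, hkl, if_false, add_zero, mul_zero]
  -- In this case the entry `(i, l)` lies on the diagonal and vanishes.
  by_cases hil : i = l
  · simp [prodFour, hil, symExt_self]
  refine (h.integral_prodFour_eq_zero ?_ ?_ ?_).le
  · simp only [ne_eq, Sym2.eq_iff]; grind
  · simp only [ne_eq, Sym2.eq_iff]; grind
  · simp only [ne_eq, Sym2.eq_iff]; grind

lemma integral_traceMoment_le [IsProbabilityMeasure μ] (h : IsNoise μ W V) :
    ∫ ω, traceMoment (symExt fun e => W e ω) ∂μ ≤ 2 * (p : ℝ) ^ 3 * V := by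
  simp only [traceMoment_eq_sum]
  have hi := h.integrable_prodFour
  simp (disch := intros; fun_prop) only [integral_finsetSum]
  calc _ ≤ ∑ k : Fin p, ∑ l : Fin p, ∑ i : Fin p, ∑ j : Fin p,
        V * ((if i = j then 1 else 0) + if k = l then 1 else 0) := by
        gcongr; exact h.integral_prodFour_trace_le _ _ _ _
    _ = _ := by
        simp [mul_add, Finset.sum_add_distrib]
        ring

lemma integrable_rowMoment [IsProbabilityMeasure μ] (h : IsNoise μ W V) :
    Integrable (fun ω => rowMoment (symExt fun e => W e ω)) μ := by
  simp only [rowMoment_eq_sum]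
  have hi := h.integrable_prodFour
  fun_prop

lemma integrable_traceMoment [IsProbabilityMeasure μ] (h : IsNoise μ W V) :
    Integrable (fun ω => traceMoment (symExt fun e => W e ω)) μ := by
  simp only [traceMoment_eq_sum]
  have hi := h.integrable_prodFour
  fun_prop

lemma measureReal_moment_le [IsProbabilityMeasure μ] (h : IsNoise μ W V) {τ : ℝ} (hτ : 0 < τ) :
    μ.real {ω | τ ^ 4 ≤ rowMoment (symExt fun e => W e ω) +
      traceMoment (symExt fun e => W e ω)} ≤ 5 * (p : ℝ) ^ 3 * V / τ ^ 4 := by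
  rw [le_div_iff₀' (by positivity)]
  refine (mul_meas_ge_le_integral_of_nonneg (.of_forall fun ω => ?_)
    (h.integrable_rowMoment.add h.integrable_traceMoment) _).trans ?_
  · exact add_nonneg (rowMoment_nonneg _) (traceMoment_nonneg _)
  · rw [integral_add' h.integrable_rowMoment h.integrable_traceMoment]
    linarith [h.integral_rowMoment_le, h.integral_traceMoment_le]

end IsNoise

end RandomMatrix

/-! ### The chain of a single edge and its martingale decomposition. -/

/-- The trajectory of an edge, driven by its initial state and its innovations. -/
def chain (z : ℕ → ℤ) : ℕ → ℤ
  | 0 => if z 0 = 1 then 1 else 0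
  | t + 1 => (if z (t + 1) = 0 then 1 else 0) + chain z t * (if z (t + 1) = 1 then 1 else 0)

lemma chain_eq_zero_or_one (z : ℕ → ℤ) (t : ℕ) : chain z t = 0 ∨ chain z t = 1 := by
  induction t with
  | zero => unfold chain; split_ifs <;> simp
  | succ t ih => unfold chain; rcases ih with h | h <;> rw [h] <;> split_ifs <;> simp_all

lemma measurable_chain (t : ℕ) : Measurable fun z : ℕ → ℤ => chain z t := by
  have hs (t : ℕ) (k : ℤ) : MeasurableSet {z : ℕ → ℤ | z t = k} :=
    measurableSet_eq_fun (measurable_pi_apply t) measurable_const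
  induction t with
  | zero => exact Measurable.ite (hs 0 1) measurable_const measurable_const
  | succ t ih =>
    exact (Measurable.ite (hs _ 0) measurable_const measurable_const).add
      (ih.mul (Measurable.ite (hs _ 1) measurable_const measurable_const))

lemma dependsOn_chain (t : ℕ) : DependsOn (fun z => chain z t) (Set.Iic t) := by
  induction t with
  | zero => intro z z' h; simp [chain, h 0 (by simp)]
  | succ t ih =>
    intro z z' h
    have : chain z t = chain z' t := ih fun s hs => h s (hs.trans (Nat.le_succ t))
    simp [chain, h (t + 1) (by simp), this]

lemma abs_chain_le_one (z : ℕ → ℤ) (t : ℕ) : |(chain z t : ℝ)| ≤ 1 := by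
  rcases chain_eq_zero_or_one z t with h | h <;> simp [h]

/-- The real-valued indicator of the innovation `k` at time `t + 1`. -/
def innovInd (k : ℤ) (t : ℕ) (z : ℕ → ℤ) : ℝ := if z (t + 1) = k then 1 else 0

lemma measurable_innovInd (k : ℤ) (t : ℕ) : Measurable (innovInd k t) :=
  Measurable.ite (measurableSet_eq_fun (measurable_pi_apply (t + 1)) measurable_const)
    measurable_const measurable_const

lemma dependsOn_innovInd (k : ℤ) (t : ℕ) : DependsOn (innovInd k t) (Set.Iic (t + 1)) := by
  intro z z' h
  simp [innovInd, h (t + 1) (by simp)]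

lemma abs_innovInd_sub_le (k : ℤ) (t : ℕ) (z : ℕ → ℤ) {q : ℝ} (h₀ : 0 ≤ q) (h₁ : q ≤ 1) :
    |innovInd k t z - q| ≤ 1 := by
  unfold innovInd
  rw [abs_le]
  split_ifs <;> constructor <;> linarith

/-- The stationary probability of the state `1`. -/
noncomputable def statProb (u : ℝ) : ℝ := Real.exp u / (1 + Real.exp u)

/-- The probability of the innovation `0`. -/
noncomputable def birthProb (u v : ℝ) : ℝ := Real.exp u / (1 + Real.exp u + Real.exp v)

/-- The probability of the innovation `1`. -/
noncomputable def keepProb (u v : ℝ) : ℝ := Real.exp v / (1 + Real.exp u + Real.exp v)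

section Parameters

variable (u v : ℝ)

lemma birthProb_add_keepProb_lt_one : birthProb u v + keepProb u v < 1 := by
  unfold birthProb keepProb
  rw [← add_div, div_lt_one (by positivity)]
  linarith

lemma birthProb_pos : 0 < birthProb u v := by unfold birthProb; positivity

lemma keepProb_pos : 0 < keepProb u v := by unfold keepProb; positivity

lemma statProb_mem_Icc : statProb u ∈ Set.Icc (0 : ℝ) 1 := by
  unfold statProb
  exact ⟨by positivity, (div_le_one (by positivity)).2 (by linarith)⟩

lemma stayZero_eq : stayZero u v = (1 - statProb u) * (1 - birthProb u v) := by
  unfold stayZero statProb birthProb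
  field_simp
  ring

lemma stayOne_eq : stayOne u v = statProb u * (birthProb u v + keepProb u v) := by
  unfold stayOne statProb birthProb keepProb
  field_simp

lemma statProb_eq : statProb u = birthProb u v + keepProb u v * statProb u := by
  unfold statProb birthProb keepProb
  field_simp

lemma stayZero_mem_Icc : stayZero u v ∈ Set.Icc (0 : ℝ) 1 := by
  have hπ := statProb_mem_Icc u
  have := birthProb_pos u v
  have := keepProb_pos u v
  have := birthProb_add_keepProb_lt_one u v
  rw [stayZero_eq]
  exact ⟨mul_nonneg (by linarith [hπ.2]) (by linarith),
    mul_le_one₀ (by linarith [hπ.1]) (by linarith) (by linarith)⟩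

lemma stayOne_mem_Icc : stayOne u v ∈ Set.Icc (0 : ℝ) 1 := by
  have hπ := statProb_mem_Icc u
  have := birthProb_pos u v
  have := keepProb_pos u v
  have := birthProb_add_keepProb_lt_one u v
  rw [stayOne_eq]
  exact ⟨mul_nonneg (by linarith [hπ.1]) (by linarith),
    mul_le_one₀ (by linarith [hπ.2]) (by linarith) (by linarith)⟩

end Parameters

/-- The deviation at time `t` of an additive functional of the chain with coefficients
`c, d₀, d₁, d₂`. -/
noncomputable def deviation (u v c d₀ d₁ d₂ : ℝ) (t : ℕ) (z : ℕ → ℤ) : ℝ :=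
  c * (chain z t - statProb u) + (d₀ + d₁ * chain z t) * (innovInd 0 t z - birthProb u v)
    + d₂ * chain z t * (innovInd 1 t z - keepProb u v)

/-- The martingale part of the deviation, multiplied by `1 - keepProb u v`. -/
noncomputable def martPart (u v c d₀ d₁ d₂ : ℝ) (t : ℕ) (z : ℕ → ℤ) : ℝ :=
  (c + (1 - keepProb u v) * (d₀ + d₁ * chain z t)) * (innovInd 0 t z - birthProb u v)
    + (c + (1 - keepProb u v) * d₂) * chain z t * (innovInd 1 t z - keepProb u v)

section Deterministic

variable (u v c d₀ d₁ d₂ : ℝ) (z : ℕ → ℤ)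

lemma chain_succ (t : ℕ) :
    (chain z (t + 1) : ℝ) = innovInd 0 t z + chain z t * innovInd 1 t z := by
  rw [chain]
  unfold innovInd
  push_cast
  rfl

/-- With `Y` the chain, `π = statProb u` and `k = keepProb u v`, the recursion reads `Y_{t+1} - π =
k (Y_t - π) + centred innovations`. Hence `(1 - k) (Y_t - π)` is `Y_t - Y_{t+1}` plus a martingale
difference, and the first part telescopes. -/
lemma sum_deviation (n : ℕ) :
    (1 - keepProb u v) * ∑ t ∈ Finset.range n, deviation u v c d₀ d₁ d₂ t z =
      c * (chain z 0 - chain z n) + ∑ t ∈ Finset.range n, martPart u v c d₀ d₁ d₂ t z := by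
  induction n with
  | zero => simp
  | succ n ih =>
    rw [Finset.sum_range_succ, Finset.sum_range_succ, mul_add, ih, chain_succ]
    unfold deviation martPart
    linear_combination (-c) * statProb_eq u v

/-- With `I` the indicator of innovation `0` and `b` its probability, the coefficients come from `(1
- Y)(1 - I) - (1 - π)(1 - b) = -(1 - b)(Y - π) - (1 - Y)(I - b)`. -/
lemma freqStayZero_sub {n : ℕ} (hn : 0 < n) :
    freqStayZero n (chain z) - stayZero u v =
      1 / (n : ℝ) * ∑ t ∈ Finset.range n, deviation u v (-(1 - birthProb u v)) (-1) 1 0 t z := by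
  have hn' : (n : ℝ) ≠ 0 := Nat.cast_ne_zero.2 hn.ne'
  have key (t : ℕ) : deviation u v (-(1 - birthProb u v)) (-1) 1 0 t z =
      (if chain z (t + 1) = 1 then 0 else if chain z t = 1 then 0 else 1) - stayZero u v := by
    rw [stayZero_eq, deviation, chain, innovInd]
    rcases chain_eq_zero_or_one z t with h | h <;> rw [h] <;> by_cases h0 : z (t + 1) = 0 <;>
      by_cases h1 : z (t + 1) = 1 <;> simp_all <;> ring
  unfold freqStayZero
  simp only [key, Finset.sum_sub_distrib, Finset.sum_const, Finset.card_range, nsmul_eq_mul]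
  field_simp

lemma freqStayOne_sub {n : ℕ} (hn : 0 < n) :
    freqStayOne n (chain z) - stayOne u v =
      1 / (n : ℝ) * ∑ t ∈ Finset.range n,
        deviation u v (birthProb u v + keepProb u v) 0 1 1 t z := by
  have hn' : (n : ℝ) ≠ 0 := Nat.cast_ne_zero.2 hn.ne'
  have key (t : ℕ) : deviation u v (birthProb u v + keepProb u v) 0 1 1 t z =
      (if chain z (t + 1) = 1 then if chain z t = 1 then 1 else 0 else 0) - stayOne u v := by
    rw [stayOne_eq, deviation, chain, innovInd, innovInd]
    rcases chain_eq_zero_or_one z t with h | h <;> rw [h] <;> by_cases h0 : z (t + 1) = 0 <;>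
      by_cases h1 : z (t + 1) = 1 <;> simp_all <;> ring
  unfold freqStayOne
  simp only [key, Finset.sum_sub_distrib, Finset.sum_const, Finset.card_range, nsmul_eq_mul]
  field_simp

/-- The numbers `d₀` and `d₀ + d₁` are the values of `d₀ + d₁ Y` at the two states, so each of the
two innovation coefficients is at most 2. -/
lemma abs_martPart_le (hc : |c| ≤ 1) (hd : d₀ ∈ Set.Icc (-1 : ℝ) 1)
    (hd' : d₀ + d₁ ∈ Set.Icc (-1 : ℝ) 1) (hd₂ : |d₂| ≤ 1) (t : ℕ) :
    |martPart u v c d₀ d₁ d₂ t z| ≤ 4 := by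
  have hk := keepProb_pos u v
  have hb := birthProb_pos u v
  have hs := birthProb_add_keepProb_lt_one u v
  have hk1 : |1 - keepProb u v| ≤ 1 := by rw [abs_le]; constructor <;> linarith
  have key (d : ℝ) (h : |d| ≤ 1) : |c + (1 - keepProb u v) * d| ≤ 2 := by
    refine (abs_add_le _ _).trans ?_
    rw [abs_mul]
    linarith [mul_le_one₀ hk1 (abs_nonneg d) h]
  have h1 : |c + (1 - keepProb u v) * (d₀ + d₁ * chain z t)| ≤ 2 := by
    apply key
    rcases chain_eq_zero_or_one z t with h | h <;> rw [h] <;> simpa [abs_le] using by assumption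
  have h2 := key d₂ hd₂
  have h3 := abs_innovInd_sub_le 0 t z hb.le (by linarith)
  have h4 := abs_innovInd_sub_le 1 t z hk.le (by linarith)
  unfold martPart
  refine (abs_add_le _ _).trans ?_
  simp only [abs_mul] at *
  have h5 := mul_le_mul h1 h3 (abs_nonneg _) zero_le_two
  have h6 := mul_le_mul (mul_le_mul h2 (abs_chain_le_one z t) (abs_nonneg _) zero_le_two) h4
    (abs_nonneg _) (by norm_num)
  linarith

end Deterministic

/-! ### Mean and variance of the transition frequencies of one edge. -/

section Probability

variable {Ω : Type*} [MeasurableSpace Ω] {μ : Measure Ω}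

/-- `Z` consists of the initial state and the innovations of an edge with parameters `u, v`. -/
structure IsDriver (μ : Measure Ω) (u v : ℝ) (Z : ℕ → Ω → ℤ) : Prop where
  indep : iIndepFun Z μ
  measurable : ∀ t, Measurable (Z t)
  init : μ.real {ω | Z 0 ω = 1} = statProb u
  birth : ∀ t, μ.real {ω | Z (t + 1) ω = 0} = birthProb u v
  keep : ∀ t, μ.real {ω | Z (t + 1) ω = 1} = keepProb u v

namespace IsDriver

variable {u v : ℝ} {Z : ℕ → Ω → ℤ}

lemma measurable_path (h : IsDriver μ u v Z) : Measurable fun ω t => Z t ω :=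
  measurable_pi_lambda _ h.measurable

lemma integral_mul_innovInd (h : IsDriver μ u v Z) {F : (ℕ → ℤ) → ℝ} (hF : Measurable F) {t : ℕ}
    (hdep : DependsOn F (Set.Iic t)) (k : ℤ) :
    ∫ ω, F (fun s => Z s ω) * innovInd k t (fun s => Z s ω) ∂μ =
      (∫ ω, F (fun s => Z s ω) ∂μ) * μ.real {ω | Z (t + 1) ω = k} := by
  have hdis : Disjoint (Finset.range (t + 1)) {t + 1} := by simp
  have hi := h.indep.indepFun_finset _ _ hdis h.measurable
  -- The past is padded by zeros, so that `F` becomes a function of finitely many coordinates;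
  -- `hdep` makes the padding irrelevant.
  let ext (f : Finset.range (t + 1) → ℤ) (s : ℕ) : ℤ :=
    if hs : s ∈ Finset.range (t + 1) then f ⟨s, hs⟩ else 0
  have hext : Measurable ext := by
    refine measurable_pi_lambda _ fun s => ?_
    by_cases hs : s ∈ Finset.range (t + 1)
    · simp only [ext, hs, dif_pos]; exact measurable_pi_apply _
    · simp only [ext, hs, dif_neg, not_false_eq_true]; exact measurable_const
  have hG : Measurable fun m : ℤ => (if m = k then 1 else 0 : ℝ) := .of_discrete
  have h2 := hi.comp (φ := fun f => F (ext f))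
    (ψ := fun f : ({t + 1} : Finset ℕ) → ℤ => (if f ⟨t + 1, by simp⟩ = k then 1 else 0 : ℝ))
    (hF.comp hext) (hG.comp (measurable_pi_apply _))
  have e1 (ω : Ω) : F (ext fun i => Z i ω) = F fun s => Z s ω := by
    refine hdep fun s hs => ?_
    have : s ∈ Finset.range (t + 1) := by
      rw [Finset.mem_range]; exact Nat.lt_succ_of_le hs
    simp only [ext, this, dif_pos]
  have h3 := h2.integral_fun_mul_eq_mul_integral
    (by simp only [Function.comp_def, e1]
        exact (hF.comp h.measurable_path).aestronglyMeasurable)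
    (hG.comp (h.measurable (t + 1))).aestronglyMeasurable
  simp only [Function.comp_def, e1] at h3
  unfold innovInd
  rw [h3]
  congr 1
  have hms : MeasurableSet {ω | Z (t + 1) ω = k} := h.measurable (t + 1) (measurableSet_singleton k)
  rw [← integral_indicator_one hms]
  congr with ω
  simp [Set.indicator_apply]

variable [IsProbabilityMeasure μ]

lemma integrable_of_bound (h : IsDriver μ u v Z) {F : (ℕ → ℤ) → ℝ} (hF : Measurable F) {C : ℝ}
    (hb : ∀ z, |F z| ≤ C) : Integrable (fun ω => F fun s => Z s ω) μ :=
  integrable_of_abs_le (hF.comp h.measurable_path) fun _ => hb _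

lemma integral_mul_innovInd_sub (h : IsDriver μ u v Z) {F : (ℕ → ℤ) → ℝ} (hF : Measurable F)
    {t : ℕ} (hdep : DependsOn F (Set.Iic t)) {C : ℝ} (hb : ∀ z, |F z| ≤ C) (k : ℤ) :
    ∫ ω, F (fun s => Z s ω) *
      (innovInd k t (fun s => Z s ω) - μ.real {ω | Z (t + 1) ω = k}) ∂μ = 0 := by
  have hi : Integrable (fun ω => F (fun s => Z s ω) * innovInd k t fun s => Z s ω) μ := by
    refine h.integrable_of_bound (F := fun z => F z * innovInd k t z)
      (hF.mul (measurable_innovInd k t)) (C := C) fun z => ?_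
    rw [abs_mul]
    have := abs_innovInd_sub_le k t z le_rfl zero_le_one
    rw [sub_zero] at this
    exact (mul_le_of_le_one_right (abs_nonneg _) this).trans (hb z)
  simp only [mul_sub]
  rw [integral_sub hi ((h.integrable_of_bound hF hb).mul_const _),
    h.integral_mul_innovInd hF hdep, integral_mul_const, sub_self]

lemma measurable_chain_real (t : ℕ) : Measurable fun z : ℕ → ℤ => (chain z t : ℝ) :=
  (measurable_from_top (f := fun m : ℤ => (m : ℝ))).comp (measurable_chain t)

lemma integral_innovInd (h : IsDriver μ u v Z) (k : ℤ) (t : ℕ) :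
    ∫ ω, innovInd k t (fun s => Z s ω) ∂μ = μ.real {ω | Z (t + 1) ω = k} := by
  simpa using h.integral_mul_innovInd (F := fun _ => 1) measurable_const (t := t)
    (fun _ _ _ => rfl) k

lemma abs_innovInd_le (k : ℤ) (t : ℕ) (z : ℕ → ℤ) : |innovInd k t z| ≤ 1 := by
  simpa using abs_innovInd_sub_le k t z le_rfl zero_le_one

lemma dependsOn_chain_real (t : ℕ) : DependsOn (fun z => (chain z t : ℝ)) (Set.Iic t) :=
  fun _ _ h => congrArg _ (dependsOn_chain t h)

lemma integral_chain (h : IsDriver μ u v Z) (t : ℕ) :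
    ∫ ω, (chain (fun s => Z s ω) t : ℝ) ∂μ = statProb u := by
  induction t with
  | zero =>
    rw [← h.init]
    have hms : MeasurableSet {ω | Z 0 ω = 1} := h.measurable 0 (measurableSet_singleton 1)
    rw [← integral_indicator_one hms]
    congr with ω
    simp [Set.indicator_apply, chain]
  | succ t ih =>
    simp only [chain_succ]
    rw [integral_add, h.integral_innovInd, h.birth,
      h.integral_mul_innovInd (measurable_chain_real t) (dependsOn_chain_real t), h.keep, ih,
      mul_comm, ← statProb_eq]
    · exact h.integrable_of_bound (measurable_innovInd 0 t) (abs_innovInd_le 0 t)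
    · refine h.integrable_of_bound (F := fun z => chain z t * innovInd 1 t z)
        ((measurable_chain_real t).mul (measurable_innovInd 1 t)) (C := 1) fun z => ?_
      rw [abs_mul]
      exact mul_le_one₀ (abs_chain_le_one z t) (abs_nonneg _) (abs_innovInd_le 1 t z)

/-- This is the martingale difference property in integrated form: `innovInd _ t` reads coordinate
`t + 1`, which is independent of the coordinates up to `t`. -/
lemma integral_mul_centred_eq_zero (h : IsDriver μ u v Z) {F G : (ℕ → ℤ) → ℝ} {t : ℕ}
    (hF : Measurable F) (hFd : DependsOn F (Set.Iic t)) {C : ℝ} (hFb : ∀ z, |F z| ≤ C)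
    (hG : Measurable G) (hGd : DependsOn G (Set.Iic t)) {D : ℝ} (hGb : ∀ z, |G z| ≤ D) :
    ∫ ω, (F (fun s => Z s ω) * (innovInd 0 t (fun s => Z s ω) - birthProb u v)
      + G (fun s => Z s ω) * (innovInd 1 t (fun s => Z s ω) - keepProb u v)) ∂μ = 0 := by
  have hk := keepProb_pos u v
  have hb := birthProb_pos u v
  have hs := birthProb_add_keepProb_lt_one u v
  have h1 := h.integral_mul_innovInd_sub hF hFd hFb 0
  have h2 := h.integral_mul_innovInd_sub hG hGd hGb 1
  rw [h.birth] at h1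
  rw [h.keep] at h2
  rw [integral_add, h1, h2, add_zero]
  · refine h.integrable_of_bound (F := fun z => F z * (innovInd 0 t z - birthProb u v))
      (hF.mul ((measurable_innovInd 0 t).sub_const _)) (C := C) fun z => ?_
    rw [abs_mul]
    exact (mul_le_of_le_one_right (abs_nonneg _)
      (abs_innovInd_sub_le 0 t z hb.le (by linarith))).trans (hFb z)
  · refine h.integrable_of_bound (F := fun z => G z * (innovInd 1 t z - keepProb u v))
      (hG.mul ((measurable_innovInd 1 t).sub_const _)) (C := D) fun z => ?_
    rw [abs_mul]
    exact (mul_le_of_le_one_right (abs_nonneg _)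
      (abs_innovInd_sub_le 1 t z hk.le (by linarith))).trans (hGb z)

lemma abs_add_mul_chain_le (a b : ℝ) (z : ℕ → ℤ) (t : ℕ) :
    |a + b * chain z t| ≤ |a| + |b| := by
  refine (abs_add_le _ _).trans ?_
  rw [abs_mul]
  linarith [mul_le_of_le_one_right (abs_nonneg b) (abs_chain_le_one z t)]

lemma measurable_add_mul_chain (a b : ℝ) (t : ℕ) :
    Measurable fun z : ℕ → ℤ => a + b * (chain z t : ℝ) :=
  ((measurable_chain_real t).const_mul b).const_add a

lemma dependsOn_add_mul_chain (a b : ℝ) (t : ℕ) :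
    DependsOn (fun z : ℕ → ℤ => a + b * (chain z t : ℝ)) (Set.Iic t) := by
  intro z z' hz
  simp only [dependsOn_chain_real t hz]

lemma integrable_and_integral_deviation (h : IsDriver μ u v Z) (c d₀ d₁ d₂ : ℝ) (t : ℕ) :
    Integrable (fun ω => deviation u v c d₀ d₁ d₂ t fun s => Z s ω) μ ∧
    ∫ ω, deviation u v c d₀ d₁ d₂ t (fun s => Z s ω) ∂μ = 0 := by
  have h1 := h.integral_mul_centred_eq_zero (measurable_add_mul_chain d₀ d₁ t)
    (dependsOn_add_mul_chain d₀ d₁ t) (fun z => abs_add_mul_chain_le d₀ d₁ z t)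
    (measurable_add_mul_chain 0 d₂ t) (dependsOn_add_mul_chain 0 d₂ t)
    (fun z => abs_add_mul_chain_le 0 d₂ z t)
  have hY := h.integrable_of_bound (measurable_chain_real t) fun z => abs_chain_le_one z t
  have h2 : ∫ ω, c * ((chain (fun s => Z s ω) t : ℝ) - statProb u) ∂μ = 0 := by
    rw [integral_const_mul, integral_sub hY (integrable_const _), h.integral_chain]
    simp
  have hi : Integrable (fun ω => c * ((chain (fun s => Z s ω) t : ℝ) - statProb u)) μ :=
    (hY.sub (integrable_const _)).const_mul c
  have hj : Integrable (fun ω => (d₀ + d₁ * (chain (fun s => Z s ω) t : ℝ)) *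
      (innovInd 0 t (fun s => Z s ω) - birthProb u v) +
      (0 + d₂ * (chain (fun s => Z s ω) t : ℝ)) *
      (innovInd 1 t (fun s => Z s ω) - keepProb u v)) μ := by
    have hk := keepProb_pos u v
    have hb := birthProb_pos u v
    have hs := birthProb_add_keepProb_lt_one u v
    refine h.integrable_of_bound (F := fun z => (d₀ + d₁ * (chain z t : ℝ)) *
      (innovInd 0 t z - birthProb u v) + (0 + d₂ * (chain z t : ℝ)) *
      (innovInd 1 t z - keepProb u v)) (((measurable_add_mul_chain d₀ d₁ t).mul
      ((measurable_innovInd 0 t).sub_const _)).add ((measurable_add_mul_chain 0 d₂ t).mul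
      ((measurable_innovInd 1 t).sub_const _))) (C := |d₀| + |d₁| + (|0| + |d₂|)) fun z => ?_
    refine (abs_add_le _ _).trans ?_
    rw [abs_mul, abs_mul]
    refine add_le_add ?_ ?_
    · exact (mul_le_of_le_one_right (abs_nonneg _)
        (abs_innovInd_sub_le 0 t z hb.le (by linarith))).trans (abs_add_mul_chain_le _ _ z t)
    · exact (mul_le_of_le_one_right (abs_nonneg _)
        (abs_innovInd_sub_le 1 t z hk.le (by linarith))).trans (abs_add_mul_chain_le _ _ z t)
  have h3 := integral_add hi hj
  rw [h1, h2, add_zero] at h3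
  have e (ω : Ω) : c * ((chain (fun s => Z s ω) t : ℝ) - statProb u) +
      ((d₀ + d₁ * (chain (fun s => Z s ω) t : ℝ)) *
      (innovInd 0 t (fun s => Z s ω) - birthProb u v) +
      (0 + d₂ * (chain (fun s => Z s ω) t : ℝ)) *
      (innovInd 1 t (fun s => Z s ω) - keepProb u v)) =
      deviation u v c d₀ d₁ d₂ t fun s => Z s ω := by
    rw [deviation]; ring
  simp only [e] at h3
  exact ⟨(hi.add hj).congr (.of_forall e), h3⟩

lemma measurable_martPart (c d₀ d₁ d₂ : ℝ) (t : ℕ) : Measurable (martPart u v c d₀ d₁ d₂ t) := by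
  have := measurable_chain_real t
  have := measurable_innovInd 0 t
  have := measurable_innovInd 1 t
  unfold martPart
  fun_prop

lemma dependsOn_martPart (c d₀ d₁ d₂ : ℝ) (t : ℕ) :
    DependsOn (martPart u v c d₀ d₁ d₂ t) (Set.Iic (t + 1)) := by
  intro z z' hz
  have : chain z t = chain z' t := dependsOn_chain t fun s hs => hz s (hs.trans (Nat.le_succ t))
  simp only [martPart, this, dependsOn_innovInd 0 t hz, dependsOn_innovInd 1 t hz]

lemma integral_sum_martPart_sq_le (h : IsDriver μ u v Z) {c d₀ d₁ d₂ : ℝ} (hc : |c| ≤ 1)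
    (hd : d₀ ∈ Set.Icc (-1 : ℝ) 1) (hd' : d₀ + d₁ ∈ Set.Icc (-1 : ℝ) 1) (hd₂ : |d₂| ≤ 1) (n : ℕ) :
    ∫ ω, (∑ t ∈ Finset.range n, martPart u v c d₀ d₁ d₂ t fun s => Z s ω) ^ 2 ∂μ ≤ 16 * n := by
  have hM := abs_martPart_le u v c d₀ d₁ d₂ (hc := hc) (hd := hd) (hd' := hd') (hd₂ := hd₂)
  have hSm (n : ℕ) : Measurable fun z => ∑ t ∈ Finset.range n, martPart u v c d₀ d₁ d₂ t z :=
    Finset.measurable_fun_sum _ fun t _ => measurable_martPart c d₀ d₁ d₂ t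
  have hSb (n : ℕ) (z : ℕ → ℤ) : |∑ t ∈ Finset.range n, martPart u v c d₀ d₁ d₂ t z| ≤ 4 * n := by
    refine (Finset.abs_sum_le_sum_abs _ _).trans ?_
    refine (Finset.sum_le_card_nsmul _ _ 4 fun t _ => hM z t).trans ?_
    simp [mul_comm]
  have hSd (n : ℕ) : DependsOn (fun z => ∑ t ∈ Finset.range n, martPart u v c d₀ d₁ d₂ t z)
      (Set.Iic n) := by
    intro z z' hz
    refine Finset.sum_congr rfl fun t ht => dependsOn_martPart c d₀ d₁ d₂ t fun s hs => hz s ?_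
    exact hs.trans (Nat.succ_le_of_lt (Finset.mem_range.1 ht))
  induction n with
  | zero => simp
  | succ n ih =>
    have hA (a b : ℝ) (z : ℕ → ℤ) :
        |(∑ t ∈ Finset.range n, martPart u v c d₀ d₁ d₂ t z) * (a + b * chain z n)| ≤
          4 * n * (|a| + |b|) := by
      rw [abs_mul]
      exact mul_le_mul (hSb n z) (abs_add_mul_chain_le a b z n) (abs_nonneg _) (by positivity)
    have hAd (a b : ℝ) : DependsOn (fun z =>
        (∑ t ∈ Finset.range n, martPart u v c d₀ d₁ d₂ t z) * (a + b * chain z n)) (Set.Iic n) := by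
      intro z z' hz
      exact congrArg₂ (· * ·) (hSd n hz) (dependsOn_add_mul_chain a b n hz)
    -- The sum of the first `n` increments uses coordinates up to `n` only, so it is orthogonal to
    -- the next increment.
    have hcross := h.integral_mul_centred_eq_zero
      ((hSm n).mul (measurable_add_mul_chain (c + (1 - keepProb u v) * d₀)
        ((1 - keepProb u v) * d₁) n)) (hAd _ _) (hA _ _)
      ((hSm n).mul (measurable_add_mul_chain 0 (c + (1 - keepProb u v) * d₂) n)) (hAd _ _) (hA _ _)
    have hcross' : ∫ ω, (∑ t ∈ Finset.range n, martPart u v c d₀ d₁ d₂ t fun s => Z s ω) *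
        martPart u v c d₀ d₁ d₂ n (fun s => Z s ω) ∂μ = 0 := by
      rw [← hcross]
      refine integral_congr_ae (.of_forall fun ω => ?_)
      simp only [martPart, Pi.mul_apply]
      ring
    have hi1 : Integrable (fun ω =>
        (∑ t ∈ Finset.range n, martPart u v c d₀ d₁ d₂ t fun s => Z s ω) ^ 2) μ := by
      refine h.integrable_of_bound (F := fun z =>
        (∑ t ∈ Finset.range n, martPart u v c d₀ d₁ d₂ t z) ^ 2) ((hSm n).pow_const 2)
        (C := (4 * n) ^ 2) fun z => ?_
      rw [abs_pow]
      exact pow_le_pow_left₀ (abs_nonneg _) (hSb n z) 2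
    have hi2 : Integrable (fun ω =>
        2 * ((∑ t ∈ Finset.range n, martPart u v c d₀ d₁ d₂ t fun s => Z s ω) *
        martPart u v c d₀ d₁ d₂ n fun s => Z s ω)) μ := by
      refine (h.integrable_of_bound (F := fun z =>
        (∑ t ∈ Finset.range n, martPart u v c d₀ d₁ d₂ t z) * martPart u v c d₀ d₁ d₂ n z)
        ((hSm n).mul (measurable_martPart _ _ _ _ n)) (C := 4 * n * 4) fun z => ?_).const_mul 2
      rw [abs_mul]
      exact mul_le_mul (hSb n z) (hM z n) (abs_nonneg _) (by positivity)
    have hi3 : Integrable (fun ω => martPart u v c d₀ d₁ d₂ n (fun s => Z s ω) ^ 2) μ := by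
      refine h.integrable_of_bound (F := fun z => martPart u v c d₀ d₁ d₂ n z ^ 2)
        ((measurable_martPart _ _ _ _ n).pow_const 2) (C := 4 ^ 2) fun z => ?_
      rw [abs_pow]
      exact pow_le_pow_left₀ (abs_nonneg _) (hM z n) 2
    have h3 : ∫ ω, martPart u v c d₀ d₁ d₂ n (fun s => Z s ω) ^ 2 ∂μ ≤ 16 := by
      refine (integral_mono hi3 (integrable_const (16 : ℝ)) fun ω => ?_).trans (by simp)
      have := sq_le_sq' (abs_le.1 (hM (fun s => Z s ω) n)).1 (abs_le.1 (hM (fun s => Z s ω) n)).2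
      simp only
      linarith
    simp only [Finset.sum_range_succ, add_sq, mul_assoc]
    have e1 := integral_add (hi1.add hi2) hi3
    simp only [Pi.add_apply] at e1
    rw [e1, integral_add hi1 hi2, integral_const_mul, hcross']
    push_cast
    linarith

/-- The telescoped boundary term is at most 1 and the martingale has second moment at most `16 n`;
`2 + 2 * 16 n ≤ 34 n`. -/
lemma integral_sum_deviation_sq_le (h : IsDriver μ u v Z) {c d₀ d₁ d₂ : ℝ} (hc : |c| ≤ 1)
    (hd : d₀ ∈ Set.Icc (-1 : ℝ) 1) (hd' : d₀ + d₁ ∈ Set.Icc (-1 : ℝ) 1) (hd₂ : |d₂| ≤ 1) {n : ℕ}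
    (hn : 0 < n) :
    ∫ ω, (1 / (n : ℝ) * ∑ t ∈ Finset.range n, deviation u v c d₀ d₁ d₂ t fun s => Z s ω) ^ 2 ∂μ ≤
      34 / (n * (1 - keepProb u v) ^ 2) := by
  have hb := birthProb_pos u v
  have hs := birthProb_add_keepProb_lt_one u v
  have hk : 0 < 1 - keepProb u v := by linarith
  have hn' : (1 : ℝ) ≤ n := Nat.one_le_cast.2 hn
  have hpt (ω : Ω) :
      (1 / (n : ℝ) * ∑ t ∈ Finset.range n, deviation u v c d₀ d₁ d₂ t fun s => Z s ω) ^ 2 ≤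
      1 / (n * (1 - keepProb u v)) ^ 2 * (2 +
        2 * (∑ t ∈ Finset.range n, martPart u v c d₀ d₁ d₂ t fun s => Z s ω) ^ 2) := by
    have e := sum_deviation u v c d₀ d₁ d₂ (fun s => Z s ω) n
    set D := ∑ t ∈ Finset.range n, deviation u v c d₀ d₁ d₂ t fun s => Z s ω
    set M := ∑ t ∈ Finset.range n, martPart u v c d₀ d₁ d₂ t fun s => Z s ω
    have e2 : (1 / (n : ℝ) * D) ^ 2 =
        1 / (n * (1 - keepProb u v)) ^ 2 * ((1 - keepProb u v) * D) ^ 2 := by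
      field_simp
    rw [e2, e]
    gcongr
    set b := c * ((chain (fun s => Z s ω) 0 : ℝ) - chain (fun s => Z s ω) n)
    have hb1 : |b| ≤ 1 := by
      rw [abs_mul]
      refine mul_le_one₀ hc (abs_nonneg _) ?_
      rcases chain_eq_zero_or_one (fun s => Z s ω) 0 with h0 | h0 <;>
        rcases chain_eq_zero_or_one (fun s => Z s ω) n with h1 | h1 <;> simp [h0, h1]
    have : b ^ 2 ≤ 1 := (sq_le_one_iff_abs_le_one b).2 hb1
    nlinarith [sq_nonneg (b - M)]
  have hM := abs_martPart_le u v c d₀ d₁ d₂ (hc := hc) (hd := hd) (hd' := hd') (hd₂ := hd₂)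
  have hi : Integrable (fun ω =>
      (∑ t ∈ Finset.range n, martPart u v c d₀ d₁ d₂ t fun s => Z s ω) ^ 2) μ := by
    refine h.integrable_of_bound (F := fun z =>
      (∑ t ∈ Finset.range n, martPart u v c d₀ d₁ d₂ t z) ^ 2)
      ((Finset.measurable_fun_sum _ fun t _ => measurable_martPart c d₀ d₁ d₂ t).pow_const 2)
      (C := (n • (4 : ℝ)) ^ 2) fun z => ?_
    rw [abs_pow]
    refine pow_le_pow_left₀ (abs_nonneg _) ((Finset.abs_sum_le_sum_abs _ _).trans ?_) 2
    simpa using Finset.sum_le_card_nsmul (Finset.range n) _ 4 fun t _ => hM z t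
  calc _ ≤ ∫ ω, 1 / (n * (1 - keepProb u v)) ^ 2 * (2 +
        2 * (∑ t ∈ Finset.range n, martPart u v c d₀ d₁ d₂ t fun s => Z s ω) ^ 2) ∂μ := by
        refine integral_mono_of_nonneg (.of_forall fun ω => sq_nonneg _)
          (((integrable_const _).add (hi.const_mul 2)).const_mul _) (.of_forall hpt)
    _ = 1 / (n * (1 - keepProb u v)) ^ 2 * (2 + 2 * ∫ ω,
        (∑ t ∈ Finset.range n, martPart u v c d₀ d₁ d₂ t fun s => Z s ω) ^ 2 ∂μ) := by
        rw [integral_const_mul, integral_add (integrable_const _) (hi.const_mul 2),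
          integral_const_mul]
        simp
    _ ≤ 1 / (n * (1 - keepProb u v)) ^ 2 * (2 * n + 2 * (16 * n)) := by
        gcongr
        · linarith
        · exact h.integral_sum_martPart_sq_le hc hd hd' hd₂ n
    _ = _ := by field_simp; norm_num

lemma integral_average_deviation (h : IsDriver μ u v Z) (c d₀ d₁ d₂ : ℝ) (n : ℕ) :
    ∫ ω, 1 / (n : ℝ) * ∑ t ∈ Finset.range n,
      deviation u v c d₀ d₁ d₂ t (fun s => Z s ω) ∂μ = 0 := by
  rw [integral_const_mul, integral_finsetSum]
  · simp [(h.integrable_and_integral_deviation _ _ _ _ _).2]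
  · exact fun t _ => (h.integrable_and_integral_deviation _ _ _ _ _).1

end IsDriver

end Probability

/-! ### Strict convexity on the ball when the noise is small. -/

section Deterministic

variable {p : ℕ}

/-- The deviation of the frequency of the transition `0 → 0`, weighted by its curvature at the true
parameter. -/
noncomputable def noiseZero (n : ℕ) (θ : Param p) (x : ℕ → Edge p → ℤ) (e : Edge p) : ℝ :=
  (freqStayZero n (fun t => x t e) - stayZero (birthPar θ e) (persistPar θ e)) *
    (Real.exp (persistPar θ e) / (1 + Real.exp (persistPar θ e)) ^ 2)

/-- The deviation of the frequency of the transition `1 → 1`, weighted by its curvature at the true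
parameter. -/
noncomputable def noiseOne (n : ℕ) (θ : Param p) (x : ℕ → Edge p → ℤ) (e : Edge p) : ℝ :=
  (freqStayOne n (fun t => x t e) - stayOne (birthPar θ e) (persistPar θ e)) *
    (Real.exp (birthPar θ e) * Real.exp (persistPar θ e) /
      (Real.exp (birthPar θ e) + Real.exp (persistPar θ e)) ^ 2)

lemma abs_birthPar_le (θ : Param p) (e : Edge p) : |birthPar θ e| ≤ 2 * ‖θ.1‖ := by
  have h1 := norm_le_pi_norm θ.1 e.1.1
  have h2 := norm_le_pi_norm θ.1 e.1.2
  rw [Real.norm_eq_abs] at h1 h2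
  exact (abs_add_le _ _).trans (by linarith)

lemma abs_persistPar_le (θ : Param p) (e : Edge p) : |persistPar θ e| ≤ 2 * ‖θ.2‖ := by
  have h1 := norm_le_pi_norm θ.2 e.1.1
  have h2 := norm_le_pi_norm θ.2 e.1.2
  rw [Real.norm_eq_abs] at h1 h2
  exact (abs_add_le _ _).trans (by linarith)

lemma abs_birthPar_sub_le {θ θ' : Param p} {r : ℝ} (h : θ' ∈ Metric.closedBall θ r) (e : Edge p) :
    |birthPar θ' e - birthPar θ e| ≤ 2 * r := by
  rw [mem_closedBall_iff_norm] at h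
  have h1 := abs_birthPar_le (θ' - θ) e
  have h2 := norm_fst_le (θ' - θ)
  have e : birthPar (θ' - θ) e = birthPar θ' e - birthPar θ e := by simp [birthPar]; ring
  rw [e] at h1
  linarith

lemma abs_persistPar_sub_le {θ θ' : Param p} {r : ℝ} (h : θ' ∈ Metric.closedBall θ r)
    (e : Edge p) : |persistPar θ' e - persistPar θ e| ≤ 2 * r := by
  rw [mem_closedBall_iff_norm] at h
  have h1 := abs_persistPar_le (θ' - θ) e
  have h2 := norm_snd_le (θ' - θ)
  have e : persistPar (θ' - θ) e = persistPar θ' e - persistPar θ e := by simp [persistPar]; ring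
  rw [e] at h1
  linarith

/-- A lower bound for the curvature, as a function of the size of the parameter. -/
noncomputable def curvBound (θ : Param p) : ℝ := Real.exp (-7 * (2 * (‖θ.1‖ + ‖θ.2‖))) / 200

lemma curvBound_pos (θ : Param p) : 0 < curvBound θ := by unfold curvBound; positivity

lemma sum_sq_add_sum_sq_pos {d : Param p} (hd : d ≠ 0) :
    0 < ∑ i, d.1 i ^ 2 + ∑ i, d.2 i ^ 2 := by
  have h1 : 0 ≤ ∑ i, d.1 i ^ 2 := Finset.sum_nonneg fun _ _ => sq_nonneg _
  have h2 : 0 ≤ ∑ i, d.2 i ^ 2 := Finset.sum_nonneg fun _ _ => sq_nonneg _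
  by_contra! h
  have e1 : ∑ i, d.1 i ^ 2 = 0 := by linarith
  have e2 : ∑ i, d.2 i ^ 2 = 0 := by linarith
  rw [Finset.sum_eq_zero_iff_of_nonneg fun _ _ => sq_nonneg _] at e1 e2
  refine hd (Prod.ext (funext fun i => ?_) (funext fun i => ?_))
  · exact pow_eq_zero_iff two_ne_zero |>.1 (e1 i (Finset.mem_univ i))
  · exact pow_eq_zero_iff two_ne_zero |>.1 (e2 i (Finset.mem_univ i))

/-- The hypotheses involve the noise at the centre `θ` only, so one event serves every point and
every direction of the ball. -/
lemma strictConvexOn_closedBall {n : ℕ} (hn : 0 < n) (hp : 3 ≤ p) (θ : Param p)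
    (x : ℕ → Fin p → Fin p → ℤ)
    (h₀ : rowMoment (symExt (noiseZero n θ fun t e => x t e.1.1 e.1.2)) +
      traceMoment (symExt (noiseZero n θ fun t e => x t e.1.1 e.1.2)) ≤
        (curvBound θ * p / 20) ^ 4)
    (h₁ : rowMoment (symExt (noiseOne n θ fun t e => x t e.1.1 e.1.2)) +
      traceMoment (symExt (noiseOne n θ fun t e => x t e.1.1 e.1.2)) ≤
        (curvBound θ * p / 20) ^ 4) :
    StrictConvexOn ℝ (Metric.closedBall θ (radius (1 / 1024) θ)) (negLogLik n x) := by
  refine strictConvexOn_negLogLik hn (by omega) x (convex_closedBall _ _) fun θ' hθ' d hd => ?_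
  have ha := curvBound_pos θ
  have hp' : (3 : ℝ) ≤ p := by exact_mod_cast hp
  have hr₀ : 0 ≤ radius (1 / 1024) θ := by unfold radius; positivity
  have hr₁ : radius (1 / 1024) θ ≤ 1 / 2 := by
    have : Real.exp (-4 * ‖θ.1‖ - 4 * ‖θ.2‖) ≤ 1 :=
      Real.exp_le_one_iff.2 (by linarith [norm_nonneg θ.1, norm_nonneg θ.2])
    unfold radius
    linarith
  have hκ₀ := norm_nonneg θ.1
  have hκ₁ := norm_nonneg θ.2
  have hA (e : Edge p) : curvBound θ ≤ Real.exp (birthPar θ' e) /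
      (1 + Real.exp (birthPar θ' e) + Real.exp (persistPar θ' e)) ^ 2 := by
    have hu := abs_birthPar_le θ e
    have hv := abs_persistPar_le θ e
    have hu' := abs_birthPar_sub_le hθ' e
    have hv' := abs_persistPar_sub_le hθ' e
    -- The extra 1 covers the displacement `2 r ≤ 1`. It costs `exp 3 ≤ 22`, and `9 * 22 ≤ 200`
    -- explains the constant in `curvBound`.
    refine le_trans ?_ (exp_neg_le_curvBirth (κ := 2 * (‖θ.1‖ + ‖θ.2‖) + 1) ?_ ?_)
    · have e3 : Real.exp 3 ≤ 22 := by
        have := pow_le_pow_left₀ (Real.exp_pos 1).le Real.exp_one_lt_d9.le 3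
        rw [← Real.exp_nat_mul] at this
        norm_num at this
        linarith
      have e4 : Real.exp (-7 * (2 * (‖θ.1‖ + ‖θ.2‖))) ≤
          Real.exp (-3 * (2 * (‖θ.1‖ + ‖θ.2‖) + 1)) * Real.exp 3 := by
        rw [← Real.exp_add]
        exact Real.exp_le_exp.2 (by linarith)
      have := Real.exp_pos (-3 * (2 * (‖θ.1‖ + ‖θ.2‖) + 1))
      unfold curvBound
      nlinarith
    · rw [abs_le] at *; constructor <;> linarith
    · rw [abs_le] at *; constructor <;> linarith
  have hB (e : Edge p) : curvBound θ - noiseZero n θ (fun t e => x t e.1.1 e.1.2) e ≤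
      curvPersist (freqStayZero n fun t => x t e.1.1 e.1.2) (birthPar θ' e) (persistPar θ' e) := by
    have hu := abs_birthPar_le θ e
    have hv := abs_persistPar_le θ e
    have hq := freqStayZero_mem_Icc hn fun t => x t e.1.1 e.1.2
    refine le_trans ?_ (curvPersist_lower hu hv hr₀ le_rfl (abs_birthPar_sub_le hθ' e)
      (abs_persistPar_sub_le hθ' e) hq.1 hq.2)
    have hb := exp_neg_le_curvPersist (κ := 2 * (‖θ.1‖ + ‖θ.2‖)) (hu.trans (by linarith))
      (hv.trans (by linarith))
    have := Real.exp_pos (-7 * (2 * (‖θ.1‖ + ‖θ.2‖)))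
    unfold noiseZero curvBound
    linarith
  have hC (e : Edge p) : - noiseOne n θ (fun t e => x t e.1.1 e.1.2) e ≤
      curvMixed (freqStayOne n fun t => x t e.1.1 e.1.2) (birthPar θ' e) (persistPar θ' e) := by
    have hq := freqStayOne_mem_Icc hn fun t => x t e.1.1 e.1.2
    exact curvMixed_lower (abs_birthPar_le θ e) (abs_persistPar_le θ e) hr₀ le_rfl
      (abs_birthPar_sub_le hθ' e) (abs_persistPar_sub_le hθ' e) hq.1 hq.2
  set w₀ := noiseZero n θ fun t e => x t e.1.1 e.1.2
  set w₁ := noiseOne n θ fun t e => x t e.1.1 e.1.2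
  have hτ : 0 ≤ curvBound θ * p / 20 := by positivity
  have n₀ := sum_mul_add_sq_le (w := w₀) hτ (by linarith [traceMoment_nonneg (symExt w₀)])
    (by linarith [rowMoment_nonneg (symExt w₀)]) d.2
  have n₁ := sum_mul_add_sq_le (w := w₁) hτ (by linarith [traceMoment_nonneg (symExt w₁)])
    (by linarith [rowMoment_nonneg (symExt w₁)]) (d.1 - d.2)
  have m₁ := sub_two_mul_le_sum_add_sq d.1
  have m₂ := sub_two_mul_le_sum_add_sq d.2
  have hpos := sum_sq_add_sum_sq_pos hd
  have hz : ∑ i, (d.1 - d.2) i ^ 2 ≤ 2 * (∑ i, d.1 i ^ 2 + ∑ i, d.2 i ^ 2) := by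
    rw [← Finset.sum_add_distrib, Finset.mul_sum]
    refine Finset.sum_le_sum fun i _ => ?_
    rw [Pi.sub_apply]
    nlinarith [sq_nonneg (d.1 i + d.2 i)]
  have hS₁ : 0 ≤ ∑ i, d.1 i ^ 2 := Finset.sum_nonneg fun _ _ => sq_nonneg _
  set S₁ := ∑ i, d.1 i ^ 2
  set S₂ := ∑ i, d.2 i ^ 2
  -- For `p ≥ 3` one has `p - 2 ≥ p / 3`. The noise takes at most `p / 10 + p / 5` from the
  -- coefficient of `S₂`, which leaves `p / 30`.
  calc 0 < curvBound θ * p / 30 * (S₁ + S₂) := by positivity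
    _ ≤ curvBound θ * ((p - 2) * S₁) + curvBound θ * ((p - 2) * S₂)
        - 2 * (curvBound θ * p / 20) * S₂
        - 2 * (curvBound θ * p / 20) * (2 * (S₁ + S₂)) := by
        have : 0 ≤ curvBound θ * (p - 3) * (S₁ + S₂) :=
          mul_nonneg (mul_nonneg ha.le (by linarith)) hpos.le
        have : 0 ≤ curvBound θ * p * S₁ := by positivity
        linarith
    _ ≤ curvBound θ * ∑ e : Edge p, (d.1 e.1.1 + d.1 e.1.2) ^ 2
        + curvBound θ * ∑ e : Edge p, (d.2 e.1.1 + d.2 e.1.2) ^ 2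
        - ∑ e : Edge p, w₀ e * (d.2 e.1.1 + d.2 e.1.2) ^ 2
        - ∑ e : Edge p, w₁ e * ((d.1 - d.2) e.1.1 + (d.1 - d.2) e.1.2) ^ 2 := by
        have := mul_le_mul_of_nonneg_left m₁ ha.le
        have := mul_le_mul_of_nonneg_left m₂ ha.le
        have := mul_le_mul_of_nonneg_left hz (mul_nonneg zero_le_two hτ)
        linarith
    _ = ∑ e : Edge p, (curvBound θ * birthPar d e ^ 2
          + (curvBound θ - w₀ e) * persistPar d e ^ 2
          + (-w₁ e) * (birthPar d e - persistPar d e) ^ 2) := by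
        rw [Finset.mul_sum, Finset.mul_sum, ← Finset.sum_add_distrib, ← Finset.sum_sub_distrib,
          ← Finset.sum_sub_distrib]
        refine Finset.sum_congr rfl fun e _ => ?_
        simp only [birthPar, persistPar, Pi.sub_apply]
        ring
    _ ≤ _ := by
        gcongr with e _
        · exact hA e
        · exact hB e
        · exact hC e

end Deterministic

/-! ### Independence of the edges and the noise of the model. -/

/-- Independence says that the joint law is a product measure, and currying carries a product over
pairs to an iterated product. It turns independent drivers into independent edge trajectories. -/
lemma iIndepFun_curry {Ω ι κ E : Type*} [MeasurableSpace Ω] {μ : Measure Ω} [MeasurableSpace E]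
    {X : ι × κ → Ω → E} (hX : ∀ q, Measurable (X q)) (h : iIndepFun X μ) :
    iIndepFun (fun (i : ι) ω (j : κ) => X (i, j) ω) μ := by
  have := h.isProbabilityMeasure
  have : ∀ i j, IsProbabilityMeasure (μ.map (X (i, j))) :=
    fun i j ↦ Measure.isProbabilityMeasure_map (hX _).aemeasurable
  have hs : iIndepFun (fun (q : (_ : ι) × κ) => X (q.1, q.2)) μ :=
    h.precomp (Equiv.sigmaEquivProd ι κ).injective
  have hc : (MeasurableEquiv.piCurry fun (_ : ι) (_ : κ) => E) ∘
      (fun ω (q : (_ : ι) × κ) ↦ X (q.1, q.2) ω) = fun ω i j ↦ X (i, j) ω := by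
    ext; simp [Sigma.curry]
  rw [iIndepFun_iff_map_fun_eq_infinitePi_map (by fun_prop)] at hs ⊢
  rw [← hc, ← Measure.map_map (by fun_prop) (by fun_prop), hs,
    Measure.infinitePi_map_piCurry (fun i j ↦ μ.map (X (i, j)))]
  congr with i : 1
  rw [← (iIndepFun_iff_map_fun_eq_infinitePi_map (by fun_prop)).1
    (h.precomp (g := fun j => (i, j)) fun _ _ => by simp)]

section Model

variable {p : ℕ} {Ω : Type*} [MeasurableSpace Ω] {μ : Measure Ω} {θ : Param p}
  {X ε : ℕ → Fin p → Fin p → Ω → ℤ}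

/-- The trajectory of the edge `e`, as a function of its initial state and its innovations. -/
def edgePath (X ε : ℕ → Fin p → Fin p → Ω → ℤ) (ω : Ω) (t : ℕ) (e : Edge p) : ℤ :=
  chain (fun s => driver X ε (e, s) ω) t

lemma div_sq_add_le_one {a b : ℝ} (ha : 0 < a) (hb : 0 < b) :
    a * b / (a + b) ^ 2 ∈ Set.Icc (0 : ℝ) 1 :=
  ⟨by positivity, (div_le_one (by positivity)).2 (by nlinarith)⟩

lemma measurable_freqStayZero (n : ℕ) : Measurable (freqStayZero n) := by
  have hs (t : ℕ) : MeasurableSet {f : ℕ → ℤ | f t = 1} :=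
    measurableSet_eq_fun (measurable_pi_apply t) measurable_const
  unfold freqStayZero
  exact (Finset.measurable_fun_sum _ fun t _ => Measurable.ite (hs _) measurable_const
    (Measurable.ite (hs _) measurable_const measurable_const)).const_mul _

lemma measurable_freqStayOne (n : ℕ) : Measurable (freqStayOne n) := by
  have hs (t : ℕ) : MeasurableSet {f : ℕ → ℤ | f t = 1} :=
    measurableSet_eq_fun (measurable_pi_apply t) measurable_const
  unfold freqStayOne
  exact (Finset.measurable_fun_sum _ fun t _ => Measurable.ite (hs _)
    (Measurable.ite (hs _) measurable_const measurable_const) measurable_const).const_mul _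

lemma measurable_chain_path : Measurable chain :=
  measurable_pi_lambda _ measurable_chain

/-- A bound for the variance of the noise on an edge. -/
noncomputable def varBound (n : ℕ) (θ : Param p) : ℝ :=
  306 * Real.exp (2 * (2 * (‖θ.1‖ + ‖θ.2‖))) / n

/-- The gap `1 - keepProb` is at least the probability of innovation `-1`, hence at least `exp (-κ)
/ 3` with `κ = 2 (‖θ.1‖ + ‖θ.2‖)`; `34 * 9 = 306`. -/
lemma variance_le_varBound {n : ℕ} (hn : 0 < n) (θ : Param p) (e : Edge p) :
    34 / (n * (1 - keepProb (birthPar θ e) (persistPar θ e)) ^ 2) ≤ varBound n θ := by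
  have hn' : (0 : ℝ) < n := Nat.cast_pos.2 hn
  have hD := denom_le (κ := 2 * (‖θ.1‖ + ‖θ.2‖))
    ((abs_birthPar_le θ e).trans (by linarith [norm_nonneg θ.2]))
    ((abs_persistPar_le θ e).trans (by linarith [norm_nonneg θ.1]))
  have hk : 1 / (3 * Real.exp (2 * (‖θ.1‖ + ‖θ.2‖))) ≤
      1 - keepProb (birthPar θ e) (persistPar θ e) := by
    have : 1 / (1 + Real.exp (birthPar θ e) + Real.exp (persistPar θ e)) ≤
        1 - keepProb (birthPar θ e) (persistPar θ e) := by
      have h1 := birthProb_pos (birthPar θ e) (persistPar θ e)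
      have h2 : 1 / (1 + Real.exp (birthPar θ e) + Real.exp (persistPar θ e)) =
          1 - birthProb (birthPar θ e) (persistPar θ e)
            - keepProb (birthPar θ e) (persistPar θ e) := by
        unfold birthProb keepProb
        field_simp
        ring
      linarith
    exact (one_div_le_one_div_of_le (by positivity) hD).trans this
  calc 34 / (n * (1 - keepProb (birthPar θ e) (persistPar θ e)) ^ 2)
      ≤ 34 / (n * (1 / (3 * Real.exp (2 * (‖θ.1‖ + ‖θ.2‖)))) ^ 2) := by gcongr
    _ = varBound n θ := by
        have : Real.exp (2 * (2 * (‖θ.1‖ + ‖θ.2‖))) = Real.exp (2 * (‖θ.1‖ + ‖θ.2‖)) ^ 2 := by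
          rw [← Real.exp_nat_mul]; norm_num
        rw [varBound, this]
        field_simp
        norm_num

namespace IsModelWith

lemma measurable_driver (h : IsModelWith μ θ X ε) (q : Edge p × ℕ) :
    Measurable (driver X ε q) := by
  unfold driver
  split_ifs
  · exact h.measurable_X _ _ _
  · exact h.measurable_innov _ _ _

lemma isDriver (h : IsModelWith μ θ X ε) (e : Edge p) :
    IsDriver μ (birthPar θ e) (persistPar θ e) fun t => driver X ε (e, t) where
  indep := h.indep.precomp (g := fun t => (e, t)) fun _ _ => by simp
  measurable t := h.measurable_driver _
  init := h.init_one _ _ e.2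
  birth t := h.innov_zero (t + 1) _ _ (Nat.succ_pos t) e.2
  keep t := h.innov_one (t + 1) _ _ (Nat.succ_pos t) e.2

lemma init_eq_zero_or_one [IsProbabilityMeasure μ] (h : IsModelWith μ θ X ε) (e : Edge p) :
    ∀ᵐ ω ∂μ, X 0 e.1.1 e.1.2 ω = 0 ∨ X 0 e.1.1 e.1.2 ω = 1 := by
  have hs (k : ℤ) : MeasurableSet {ω | X 0 e.1.1 e.1.2 ω = k} :=
    h.measurable_X 0 _ _ (measurableSet_singleton k)
  have hdis : Disjoint {ω | X 0 e.1.1 e.1.2 ω = 0} {ω | X 0 e.1.1 e.1.2 ω = 1} := by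
    rw [Set.disjoint_left]
    intro ω h0 h1
    simp only [Set.mem_ofPred_eq] at h0 h1
    omega
  have hu := measureReal_union (μ := μ) hdis (hs 1)
  rw [h.init_one _ _ e.2, h.init_zero _ _ e.2] at hu
  have hpos : 0 < alpha0 θ e.1.1 e.1.2 := Real.exp_pos _
  rw [← add_div, div_self (by positivity), measureReal_def, ENNReal.toReal_eq_one_iff,
    ← mem_ae_iff_prob_eq_one ((hs 0).union (hs 1))] at hu
  exact hu

/-- The observed process can be replaced by `edgePath`, which takes values in `{0, 1}` everywhere
and is an exact function of the drivers of its edge. -/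
lemma ae_eq_edgePath [IsProbabilityMeasure μ] (h : IsModelWith μ θ X ε) :
    ∀ᵐ ω ∂μ, ∀ (t : ℕ) (e : Edge p), X t e.1.1 e.1.2 ω = edgePath X ε ω t e := by
  have h1 : ∀ᵐ ω ∂μ, ∀ (t : ℕ) (e : Edge p), X (t + 1) e.1.1 e.1.2 ω =
      (if ε (t + 1) e.1.1 e.1.2 ω = 0 then 1 else 0)
        + X t e.1.1 e.1.2 ω * (if ε (t + 1) e.1.1 e.1.2 ω = 1 then 1 else 0) := by
    rw [ae_all_iff]; intro t
    rw [ae_all_iff]; intro e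
    exact h.step t _ _ e.2
  filter_upwards [h1, ae_all_iff.2 h.init_eq_zero_or_one] with ω hω h0 t e
  induction t with
  | zero =>
    unfold edgePath chain driver
    rcases h0 e with h | h <;> simp [h]
  | succ t ih =>
    rw [hω, ih]
    simp [edgePath, chain, driver]

lemma iIndepFun_path (h : IsModelWith μ θ X ε) :
    iIndepFun (fun (e : Edge p) ω t => edgePath X ε ω t e) μ :=
  (iIndepFun_curry h.measurable_driver h.indep).comp (fun _ => chain)
    fun _ => measurable_chain_path

lemma measurable_path (h : IsModelWith μ θ X ε) (e : Edge p) :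
    Measurable fun ω t => edgePath X ε ω t e :=
  measurable_chain_path.comp (measurable_pi_lambda _ fun _ => h.measurable_driver _)

end IsModelWith

lemma abs_sub_mul_le_one {a b c : ℝ} (ha : a ∈ Set.Icc (0 : ℝ) 1) (hb : b ∈ Set.Icc (0 : ℝ) 1)
    (hc : c ∈ Set.Icc (0 : ℝ) 1) : |(a - b) * c| ≤ 1 := by
  rw [abs_mul, abs_of_nonneg hc.1]
  refine mul_le_one₀ ?_ hc.1 hc.2
  rw [abs_le]
  constructor <;> linarith [ha.1, ha.2, hb.1, hb.2]

lemma integral_mul_const_sq_le {f : Ω → ℝ} {c V : ℝ} (hc : c ∈ Set.Icc (0 : ℝ) 1)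
    (hf : ∫ ω, f ω ^ 2 ∂μ ≤ V) : ∫ ω, (f ω * c) ^ 2 ∂μ ≤ V := by
  simp only [mul_pow, integral_mul_const]
  have h0 : 0 ≤ ∫ ω, f ω ^ 2 ∂μ := integral_nonneg fun _ => sq_nonneg _
  exact (mul_le_of_le_one_right h0 (pow_le_one₀ hc.1 hc.2)).trans hf

lemma IsModelWith.isNoise_noiseZero [IsProbabilityMeasure μ] (h : IsModelWith μ θ X ε) {n : ℕ}
    (hn : 0 < n) :
    IsNoise μ (fun e ω => noiseZero n θ (edgePath X ε ω) e) (varBound n θ) := by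
  have hc (e : Edge p) : Real.exp (persistPar θ e) / (1 + Real.exp (persistPar θ e)) ^ 2 ∈
      Set.Icc (0 : ℝ) 1 := by
    simpa using div_sq_add_le_one one_pos (Real.exp_pos (persistPar θ e))
  have hG (e : Edge p) : Measurable fun f : ℕ → ℤ =>
      (freqStayZero n f - stayZero (birthPar θ e) (persistPar θ e)) *
        (Real.exp (persistPar θ e) / (1 + Real.exp (persistPar θ e)) ^ 2) :=
    ((measurable_freqStayZero n).sub_const _).mul_const _
  have hb (u v : ℝ) : |-(1 - birthProb u v)| ≤ 1 := by
    have := birthProb_pos u v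
    have := keepProb_pos u v
    have := birthProb_add_keepProb_lt_one u v
    rw [abs_neg, abs_le]
    constructor <;> linarith
  refine ⟨h.iIndepFun_path.comp _ hG, fun e => (hG e).comp (h.measurable_path e), fun e => ?_,
    fun e ω => abs_sub_mul_le_one (freqStayZero_mem_Icc hn _) (stayZero_mem_Icc _ _) (hc e),
    fun e => integral_mul_const_sq_le (hc e) ?_, by unfold varBound; positivity⟩
  · unfold noiseZero edgePath
    simp only [freqStayZero_sub _ _ _ hn, integral_mul_const]
    rw [(h.isDriver e).integral_average_deviation, zero_mul]
  · unfold edgePath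
    simp only [freqStayZero_sub _ _ _ hn]
    exact ((h.isDriver e).integral_sum_deviation_sq_le (hb _ _) (by norm_num) (by norm_num)
      (by norm_num) hn).trans (variance_le_varBound hn θ e)

lemma IsModelWith.isNoise_noiseOne [IsProbabilityMeasure μ] (h : IsModelWith μ θ X ε) {n : ℕ}
    (hn : 0 < n) :
    IsNoise μ (fun e ω => noiseOne n θ (edgePath X ε ω) e) (varBound n θ) := by
  have hc (e : Edge p) := div_sq_add_le_one (Real.exp_pos (birthPar θ e))
    (Real.exp_pos (persistPar θ e))
  have hG (e : Edge p) : Measurable fun f : ℕ → ℤ =>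
      (freqStayOne n f - stayOne (birthPar θ e) (persistPar θ e)) *
        (Real.exp (birthPar θ e) * Real.exp (persistPar θ e) /
          (Real.exp (birthPar θ e) + Real.exp (persistPar θ e)) ^ 2) :=
    ((measurable_freqStayOne n).sub_const _).mul_const _
  have hb (u v : ℝ) : |birthProb u v + keepProb u v| ≤ 1 := by
    have := birthProb_pos u v
    have := keepProb_pos u v
    have := birthProb_add_keepProb_lt_one u v
    rw [abs_le]
    constructor <;> linarith
  refine ⟨h.iIndepFun_path.comp _ hG, fun e => (hG e).comp (h.measurable_path e), fun e => ?_,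
    fun e ω => abs_sub_mul_le_one (freqStayOne_mem_Icc hn _) (stayOne_mem_Icc _ _) (hc e),
    fun e => integral_mul_const_sq_le (hc e) ?_, by unfold varBound; positivity⟩
  · unfold noiseOne edgePath
    simp only [freqStayOne_sub _ _ _ hn, integral_mul_const]
    rw [(h.isDriver e).integral_average_deviation, zero_mul]
  · unfold edgePath
    simp only [freqStayOne_sub _ _ _ hn]
    exact ((h.isDriver e).integral_sum_deviation_sq_le (hb _ _) (by norm_num) (by norm_num)
      (by norm_num) hn).trans (variance_le_varBound hn θ e)

end Model

/-! ### The tail bound and the conclusion. -/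

/-- The constant in the bound for the probability of an irregular sample. -/
noncomputable def tailConst : ℝ := 5 * 306 * 200 ^ 4 * 20 ^ 4

lemma tail_le {n p : ℕ} (hn : 0 < n) (hp : 0 < p) {θ : Param p}
    (hθ : ‖θ.1‖ + ‖θ.2‖ ≤ 1 / 120 * Real.log ((n : ℝ) * (p : ℝ))) :
    5 * (p : ℝ) ^ 3 * varBound n θ / (curvBound θ * p / 20) ^ 4 ≤
      tailConst / Real.sqrt ((n : ℝ) * p) := by
  have hn' : (0 : ℝ) < n := Nat.cast_pos.2 hn
  have hp' : (0 : ℝ) < p := Nat.cast_pos.2 hp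
  have hs : 0 < Real.sqrt ((n : ℝ) * p) := Real.sqrt_pos.2 (by positivity)
  set κ := 2 * (‖θ.1‖ + ‖θ.2‖) with hκ
  -- The exponent is `2` from the variance plus `4 * 7` from the fourth power of `curvBound`. As `30
  -- κ = 60 (‖θ.1‖ + ‖θ.2‖)`, the constant `1 / 120` leaves exactly half of `log (n p)`.
  have hE : Real.exp (30 * κ) ≤ Real.sqrt ((n : ℝ) * p) := by
    rw [Real.le_sqrt' (Real.exp_pos _), ← Real.exp_nat_mul, ← Real.le_log_iff_exp_le (by positivity)]
    push_cast
    linarith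
  have e1 : 5 * (p : ℝ) ^ 3 * varBound n θ / (curvBound θ * p / 20) ^ 4 =
      tailConst * Real.exp (30 * κ) / (n * p) := by
    have h1 : Real.exp (30 * κ) = Real.exp κ ^ 30 := by rw [← Real.exp_nat_mul]; norm_num
    have h2 : Real.exp (2 * κ) = Real.exp κ ^ 2 := by rw [← Real.exp_nat_mul]; norm_num
    have h3 : Real.exp (-7 * κ) = (Real.exp κ ^ 7)⁻¹ := by
      rw [← Real.exp_nat_mul, ← Real.exp_neg]; norm_num
    rw [varBound, curvBound, ← hκ, h1, h2, h3, tailConst]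
    field_simp
  rw [e1, div_le_div_iff₀ (by positivity) hs]
  have : Real.sqrt ((n : ℝ) * p) * Real.sqrt ((n : ℝ) * p) = n * p :=
    Real.mul_self_sqrt (by positivity)
  have hc : 0 < tailConst := by unfold tailConst; positivity
  calc _ ≤ tailConst * Real.sqrt ((n : ℝ) * p) * Real.sqrt ((n : ℝ) * p) := by gcongr
    _ = _ := by rw [mul_assoc, this]

end TWHM

theorem theorem1 (K : ℝ) :
    ∃ c : ℝ, 0 < c ∧ ∃ cr : ℝ, 0 < cr ∧ ∀ δ : ℝ, 0 < δ → ∃ N : ℕ,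
      ∀ (n p : ℕ), 2 ≤ n → 3 ≤ p → N ≤ n * p →
      ∀ θ : TWHM.Param p,
        (∀ i, θ.2 i - max (θ.1 i) 0 < K) →
        ‖θ.1‖ + ‖θ.2‖ ≤ c * Real.log ((n : ℝ) * (p : ℝ)) →
      ∀ (Ω : Type*) [MeasurableSpace Ω] (μ : Measure Ω) [IsProbabilityMeasure μ]
        (X : ℕ → Fin p → Fin p → Ω → ℤ),
        TWHM.IsStationaryTWHM μ θ X →
        1 - δ ≤ μ.real {ω |
          ConvexOn ℝ (Metric.closedBall θ (TWHM.radius cr θ))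
            (TWHM.negLogLik n (fun t i j => X t i j ω)) ∧
          ∃! θ' : TWHM.Param p, TWHM.IsMLEIn n (fun t i j => X t i j ω)
            (Metric.closedBall θ (TWHM.radius cr θ)) θ'} := by
  refine ⟨1 / 120, by norm_num, 1 / 1024, by norm_num, fun δ hδ => ?_⟩
  obtain ⟨N, hN⟩ := exists_nat_ge ((2 * TWHM.tailConst / δ) ^ 2)
  refine ⟨N, fun n p hn hp hnp θ _ hθ Ω _ μ _ X hX => ?_⟩
  obtain ⟨ε, h⟩ := hX
  have hn₀ : 0 < n := by omega
  have hp₀ : 0 < p := by omega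
  have hc : 0 < TWHM.tailConst := by unfold TWHM.tailConst; positivity
  have hτ : 0 < TWHM.curvBound θ * p / 20 := by
    have := TWHM.curvBound_pos θ
    positivity
  have hs : 0 < Real.sqrt ((n : ℝ) * p) := Real.sqrt_pos.2 (by positivity)
  have htail : TWHM.tailConst / Real.sqrt ((n : ℝ) * p) ≤ δ / 2 := by
    have h1 : 2 * TWHM.tailConst / δ ≤ Real.sqrt ((n : ℝ) * p) := by
      refine Real.le_sqrt_of_sq_le (hN.trans ?_)
      exact_mod_cast hnp
    rw [div_le_iff₀ hδ] at h1
    rw [div_le_iff₀ hs]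
    linarith
  have b₀ := ((h.isNoise_noiseZero hn₀).measureReal_moment_le hτ).trans
    ((TWHM.tail_le hn₀ hp₀ hθ).trans htail)
  have b₁ := ((h.isNoise_noiseOne hn₀).measureReal_moment_le hτ).trans
    ((TWHM.tail_le hn₀ hp₀ hθ).trans htail)
  set A₀ := {ω | (TWHM.curvBound θ * p / 20) ^ 4 ≤
    TWHM.rowMoment (TWHM.symExt fun e => TWHM.noiseZero n θ (TWHM.edgePath X ε ω) e) +
    TWHM.traceMoment (TWHM.symExt fun e => TWHM.noiseZero n θ (TWHM.edgePath X ε ω) e)} with hA₀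
  set A₁ := {ω | (TWHM.curvBound θ * p / 20) ^ 4 ≤
    TWHM.rowMoment (TWHM.symExt fun e => TWHM.noiseOne n θ (TWHM.edgePath X ε ω) e) +
    TWHM.traceMoment (TWHM.symExt fun e => TWHM.noiseOne n θ (TWHM.edgePath X ε ω) e)} with hA₁
  set S := {ω | ConvexOn ℝ (Metric.closedBall θ (TWHM.radius (1 / 1024) θ))
      (TWHM.negLogLik n (fun t i j => X t i j ω)) ∧
    ∃! θ' : TWHM.Param p, TWHM.IsMLEIn n (fun t i j => X t i j ω)
      (Metric.closedBall θ (TWHM.radius (1 / 1024) θ)) θ'} with hS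
  have hsub : ∀ᵐ ω ∂μ, ω ∈ Set.univ → ω ∈ S ∪ (A₀ ∪ A₁) := by
    filter_upwards [h.ae_eq_edgePath] with ω hω _
    by_cases hA : ω ∈ A₀ ∪ A₁
    · exact Or.inr hA
    left
    simp only [hA₀, hA₁, Set.mem_union, Set.mem_ofPred_eq, not_or, not_le] at hA
    have he : (fun t e => X t e.1.1 e.1.2 ω) = TWHM.edgePath X ε ω :=
      funext fun t => funext fun e => hω t e
    have hconv := TWHM.strictConvexOn_closedBall hn₀ hp θ (fun t i j => X t i j ω)
      (by rw [he]; exact hA.1.le) (by rw [he]; exact hA.2.le)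
    refine ⟨hconv.convexOn, TWHM.existsUnique_isMLEIn (isCompact_closedBall _ _)
      (Metric.nonempty_closedBall.2 ?_) (TWHM.continuous_negLogLik hn₀ _) hconv⟩
    unfold TWHM.radius
    positivity
  -- Only monotonicity and subadditivity are used, so measurability of `S` is not needed.
  have hle : (1 : ℝ) ≤ μ.real (S ∪ (A₀ ∪ A₁)) := by
    rw [← probReal_univ (μ := μ)]
    exact ENNReal.toReal_mono (measure_ne_top _ _) (measure_mono_ae hsub)
  have := measureReal_union_le (μ := μ) S (A₀ ∪ A₁)
  have := measureReal_union_le (μ := μ) A₀ A₁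
  linarith
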